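/- Fix an integer $e\ge 2$. For a partition $\lambda=(\lambda_1,\lambda_2,\dots)$ let $\beta(\lambda)=\{\lambda_i-i : i\ge 1\}\subset\mathbb Z$, and for $b\in\beta(\lambda)$ let $\mathrm{wt}_\lambda(b)$ be the number of $x\notin\beta(\lambda)$ with $x<b$ and $x\equiv b \pmod e$. The set of bead movements of $\lambda$ is $$\mathcal A(\lambda)=\{(b;\,b-ie) : b\in\beta(\lambda),\ 0\le i<\mathrm{wt}_\lambda(b)\},$$ totally ordered by $(b;q)<(b';q')$ if $q<q'$, or $q=q'$ and $b<b'$. The $e$-weight of $\lambda$ is $w=|\mathcal A(\lambda)|=\sum_{b\in\beta(\lambda)}\mathrm{wt}_\lambda(b)$. The $e$-core of $\lambda$ is the partition $\kappa$ with $\beta(\kappa)=\{b-\mathrm{wt}_\lambda(b)e : b\in\beta(\lambda)\}$. The $r$-th component ($0\le r<e$) of the $e$-quotient of $\lambda$ is the partition whose parts are the nonzero numbers $\mathrm{wt}_\lambda(b)$ with $b\in\beta(\lambda)$, $b\equiv r \pmod e$. We call $\lambda$ a hook-quotient partition if every component of its $e$-quotient is a hook, i.e. has second part at most $1$. A block $B$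 of $e$-weight $w$ is the set of all partitions with $e$-weight $w$ and a given $e$-core. Write $\mathcal A(\lambda)=\{(b_1;q_1)<\dots<(b_w;q_w)\}$, and let $\mathbf z(\lambda)\in\mathbb Z^w$ have $i$-th coordinate $|\{x\notin\beta(\lambda): q_i-e<x\le q_i\}|$. A vector $x\in\mathbb R^w$ is $m$-increasing if $x_{i+1}-x_i\ge m$ for all $1\le i<w$; for $S\subseteq\mathbb R^w$, $S_{\ge m}$ is the set of $m$-increasing elements of $S$; and $\lambda$ is $m$-increasing if $\mathbf z(\lambda)$ is. Let $\mathbf e_1,\dots,\mathbf e_w$ be the standard basis of $\mathbb Z^w$. For each residue class $j$ modulo $e$ containing some $q_i$, let $i_1<\dots<i_r$ be the indices $i$ with $q_i\equiv j \pmod e$, let $l=\min\{s : b_{i_s}=b_{i_r}\}$, and put $$\epsilon^\lambda_{i_\gamma}=\mathbf e_{i_\gamma}-\mathbf e_{i_{\gamma+1}}\ (\gamma<l),\qquad \epsilon^\lambda_{i_l}=\mathbf e_{i_l},\qquad \epsilon^\lambda_{i_\gamma}=\mathbf e_{i_\gamma}-\mathbf e_{i_{\gamma-1}}\ (\gamma>l).$$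 Let $\Pi(\lambda)=\{\mathbf z(\lambda)+\sum_{i\in\Gamma}\epsilon^\lambda_i : \Gamma\subseteq\{1,\dots,w\}\}\subset\mathbb Z^w$ and let $\Pi(\lambda)^{\mathbb R}$, the solid parallelotope, be the convex hull of $\Pi(\lambda)$ in $\mathbb R^w$. A face of a polytope $P$ is the empty set or the set of points of $P$ at which some linear functional is maximal on $P$. A face of $\Pi(\lambda)$ is the empty set or a set $\{\mathbf z(\lambda)+\sum_{i\in\Gamma}\epsilon^\lambda_i : \Gamma_1\subseteq\Gamma\subseteq\{1,\dots,w\}\setminus\Gamma_0\}$ with $\Gamma_0,\Gamma_1$ disjoint. Let $B$ be a block of $e$-weight $w$. 1. If $\lambda,\mu\in B$ are hook-quotient partitions, then there is a common face $F$ of $\Pi(\lambda)^{\mathbb R}$ and $\Pi(\mu)^{\mathbb R}$ with $$\Pi(\lambda)^{\mathbb R}_{\ge 7}\cap\Pi(\mu)^{\mathbb R}_{\ge 7}=F_{\ge 7}.$$ 2. If moreover $\lambda$ or $\mu$ is $10$-increasing, then $\Pi(\lambda)^{\mathbb R}\cap\Pi(\mu)^{\mathbb R}$ is a face of both $\Pi(\lambda)^{\mathbb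 R}$ and $\Pi(\mu)^{\mathbb R}$, and $\Pi(\lambda)\cap\Pi(\mu)$ is a face of both $\Pi(\lambda)$ and $\Pi(\mu)$. 3. There is a pure polytopal complex in $\mathbb R^w$ whose $w$-dimensional cells are exactly the solid parallelotopes $\Pi(\lambda)^{\mathbb R}$, for $\lambda$ ranging over the $10$-increasing partitions in $B$. Here a polytopal complex is a finite set of polytopes that contains the empty polytope, is closed under taking faces, and in which any two members intersect in a face of both; it is pure if every member is contained in a member of maximal dimension. -/

import Mathlib

namespace HookQuotient

/-! ### The abacus of a partition

A partition is a `YoungDiagram`; its `(i+1)`-st part is `lam.rowLen i`. -/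

/-- The set of beta-numbers `{lam_1 - 1, lam_2 - 2, ...}` (the positions of the beads). -/
def beta (lam : YoungDiagram) : Set ℤ :=
  Set.range fun i : ℕ => (lam.rowLen i : ℤ) - ((i : ℤ) + 1)

/-- The number of unoccupied positions above `b` on its runner of the `e`-abacus. -/
noncomputable def wt (e : ℕ) (lam : YoungDiagram) (b : ℤ) : ℕ :=
  {x : ℤ | x ∉ beta lam ∧ x < b ∧ x ≡ b [ZMOD (e : ℤ)]}.ncard

theorem mem_beta_of_lt (lam : YoungDiagram) (x : ℤ) (hx : x < -(lam.colLen 0 : ℤ)) :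
    x ∈ beta lam := by
  refine ⟨(-x - 1).toNat, ?_⟩
  have h0 : lam.rowLen (-x - 1).toNat = 0 := by
    by_contra h
    have h1 : ((-x - 1).toNat, 0) ∈ lam := by
      rw [YoungDiagram.mem_iff_lt_rowLen]; omega
    rw [YoungDiagram.mem_iff_lt_colLen] at h1
    omega
  simp only [h0]
  omega

theorem movable_finite (e : ℕ) (lam : YoungDiagram) :
    {b : ℤ | b ∈ beta lam ∧ 0 < wt e lam b}.Finite := by
  refine (Set.finite_Icc (-(lam.colLen 0 : ℤ)) (lam.rowLen 0 : ℤ)).subset ?_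
  rintro b ⟨⟨i, rfl⟩, hw⟩
  constructor
  · obtain ⟨x, hx, hlt, -⟩ := Set.nonempty_of_ncard_ne_zero hw.ne'
    by_contra hcon
    exact hx (mem_beta_of_lt lam x (by omega))
  · have := lam.rowLen_anti 0 i (Nat.zero_le i)
    simp only
    omega

/-- The (finitely many) beads that have at least one unoccupied position above them on their
runner. -/
noncomputable def movableBeads (e : ℕ) (lam : YoungDiagram) : Finset ℤ :=
  (movable_finite e lam).toFinset

/-- The set of bead movements `(b; q)`, where `b` is a bead and `q = b - i e` with
`0 ≤ i < wt b`.  The movement `(b; q)` is stored as the pair `(q, b)` with the lexicographic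
order, so that movements are ordered first by starting position `q`, and then by `b`. -/
noncomputable def movements (e : ℕ) (lam : YoungDiagram) : Finset (ℤ ×ₗ ℤ) :=
  (movableBeads e lam).biUnion fun b =>
    (Finset.range (wt e lam b)).image fun i : ℕ => toLex (b - (i : ℤ) * (e : ℤ), b)

/-- The `e`-weight of a partition: the number of its bead movements, which is also the sum of the
weights of its beads (see `eWeight_eq_sum`). -/
noncomputable def eWeight (e : ℕ) (lam : YoungDiagram) : ℕ := (movements e lam).card

theorem eWeight_eq_sum (e : ℕ) (he : 2 ≤ e) (lam : YoungDiagram) :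
    eWeight e lam = ∑ b ∈ movableBeads e lam, wt e lam b := by
  unfold eWeight movements
  rw [Finset.card_biUnion]
  · refine Finset.sum_congr rfl fun b _ => ?_
    rw [Finset.card_image_of_injective, Finset.card_range]
    intro i j hij
    have h := congrArg (fun p => (ofLex p).1) hij
    simp only [ofLex_toLex] at h
    have h2 : (i : ℤ) * (e : ℤ) = (j : ℤ) * (e : ℤ) := by linarith
    have h3 : (e : ℤ) ≠ 0 := by positivity
    exact_mod_cast mul_right_cancel₀ h3 h2
  · intro b _ c _ hbc
    simp only [Function.onFun]
    rw [Finset.disjoint_left]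
    intro p hp hq
    simp only [Finset.mem_image] at hp hq
    obtain ⟨i, -, rfl⟩ := hp
    obtain ⟨j, -, h⟩ := hq
    exact hbc (congrArg (fun p => (ofLex p).2) h).symm

/-- `kappa` is the `e`-core of `lam`: its abacus arises from that of `lam` by sliding every bead as
far up its runner as possible, so that a bead `b` ends at `b - (wt b) e`. -/
def HasCore (e : ℕ) (lam kappa : YoungDiagram) : Prop :=
  beta kappa = (fun b : ℤ => b - (wt e lam b : ℤ) * (e : ℤ)) '' beta lam

/-- The parts of the `r`-th component of the `e`-quotient: the nonzero weights of the beads on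
runner `r`. -/
noncomputable def quotientParts (e : ℕ) (lam : YoungDiagram) (r : ℕ) : Multiset ℕ :=
  ((movableBeads e lam).filter fun b => b ≡ (r : ℤ) [ZMOD (e : ℤ)]).val.map (wt e lam)

/-- The `r`-th component of the `e`-quotient, a partition. -/
noncomputable def eQuotient (e : ℕ) (lam : YoungDiagram) (r : ℕ) : YoungDiagram :=
  YoungDiagram.ofRowLens ((quotientParts e lam r).sort (· ≥ ·))
    ((quotientParts e lam r).pairwise_sort (· ≥ ·)).sortedGE

/-- A hook is a partition whose second part is at most `1`. -/
def IsHook (nu : YoungDiagram) : Prop := nu.rowLen 1 ≤ 1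

/-- Every component of the `e`-quotient is a hook. -/
def IsHookQuotient (e : ℕ) (lam : YoungDiagram) : Prop :=
  ∀ r < e, IsHook (eQuotient e lam r)

/-- The number of positions in `(x - e, x]` that are not occupied. -/
noncomputable def zAt (e : ℕ) (lam : YoungDiagram) (x : ℤ) : ℕ :=
  {y : ℤ | x - (e : ℤ) < y ∧ y ≤ x ∧ y ∉ beta lam}.ncard

/-! ### Blocks, the labelling, and the parallelotopes -/

/-- Partitions of `e`-weight `w`. -/
def WeightPartition (e w : ℕ) : Type := {lam : YoungDiagram // eWeight e lam = w}

/-- The block of partitions with `e`-weight `w` and `e`-core `kappa`. -/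
def block (e : ℕ) (kappa : YoungDiagram) (w : ℕ) : Set (WeightPartition e w) :=
  {lam | HasCore e lam.1 kappa}

section Parallelotopes

variable {e w : ℕ}

/-- The list of bead movements in increasing order. -/
noncomputable def movement (lam : WeightPartition e w) : Fin w ↪o (ℤ ×ₗ ℤ) :=
  (movements e lam.1).orderEmbOfFin lam.2

/-- The starting position `q_i` of the `i`-th bead movement `(b_i; q_i)`. -/
noncomputable def startPos (lam : WeightPartition e w) (i : Fin w) : ℤ := (ofLex (movement lam i)).1

/-- The bead `b_i` of the `i`-th bead movement `(b_i; q_i)`. -/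
noncomputable def bead (lam : WeightPartition e w) (i : Fin w) : ℤ := (ofLex (movement lam i)).2

/-- The label `z(lam)`, an element of `ℤ^w`. -/
noncomputable def zLabel (lam : WeightPartition e w) : Fin w → ℤ :=
  fun i => (zAt e lam.1 (startPos lam i) : ℤ)

/-- The indices of the bead movements on the same runner as the `i`-th one. -/
noncomputable def sameRunner (lam : WeightPartition e w) (i : Fin w) : Finset (Fin w) :=
  Finset.univ.filter fun k => startPos lam k ≡ startPos lam i [ZMOD (e : ℤ)]

theorem sameRunner_nonempty (lam : WeightPartition e w) (i : Fin w) :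
    (sameRunner lam i).Nonempty :=
  ⟨i, by simp [sameRunner]⟩

/-- The index of the largest bead movement on the runner of the `i`-th one. -/
noncomputable def lastOnRunner (lam : WeightPartition e w) (i : Fin w) : Fin w :=
  (sameRunner lam i).max' (sameRunner_nonempty lam i)

theorem finalMoves_nonempty (lam : WeightPartition e w) (i : Fin w) :
    ((sameRunner lam i).filter fun k => bead lam k = bead lam (lastOnRunner lam i)).Nonempty :=
  ⟨lastOnRunner lam i, Finset.mem_filter.mpr ⟨Finset.max'_mem _ _, rfl⟩⟩

/-- The index of the final bead movement of the bottom bead on the runner of the `i`-th bead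
movement. -/
noncomputable def pivot (lam : WeightPartition e w) (i : Fin w) : Fin w :=
  ((sameRunner lam i).filter fun k => bead lam k = bead lam (lastOnRunner lam i)).min'
    (finalMoves_nonempty lam i)

theorem pivot_mem (lam : WeightPartition e w) (i : Fin w) : pivot lam i ∈ sameRunner lam i :=
  (Finset.mem_filter.mp (Finset.min'_mem _ (finalMoves_nonempty lam i))).1

/-- The modified basis vector `ε_i` of `ℤ^w`: it is `e_i - e_{i'}` with `i'` the next index on the
runner if `i` comes before the pivot, `e_i` if `i` is the pivot, and `e_i - e_{i'}` with `i'` the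
previous index on the runner if `i` comes after the pivot. -/
noncomputable def modBasis (lam : WeightPartition e w) (i : Fin w) : Fin w → ℤ :=
  if h : i < pivot lam i then
    Pi.single i 1 - Pi.single (((sameRunner lam i).filter fun k => i < k).min'
      ⟨pivot lam i, Finset.mem_filter.mpr ⟨pivot_mem lam i, h⟩⟩) 1
  else if h : pivot lam i < i then
    Pi.single i 1 - Pi.single (((sameRunner lam i).filter fun k => k < i).max'
      ⟨pivot lam i, Finset.mem_filter.mpr ⟨pivot_mem lam i, h⟩⟩) 1
  else Pi.single i 1

/-- The vertex `z(lam) + ∑_{i ∈ Γ} ε_i` of the parallelotope of `lam`. -/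
noncomputable def vertex (lam : WeightPartition e w) (Γ : Finset (Fin w)) : Fin w → ℤ :=
  zLabel lam + ∑ i ∈ Γ, modBasis lam i

/-- The (discrete) parallelotope `Π(lam) ⊆ ℤ^w`. -/
def parallelotope (lam : WeightPartition e w) : Set (Fin w → ℤ) :=
  Set.range (vertex lam)

/-- The solid parallelotope: the convex hull of `Π(lam)` in `ℝ^w`. -/
def solidParallelotope (lam : WeightPartition e w) : Set (Fin w → ℝ) :=
  convexHull ℝ ((fun (x : Fin w → ℤ) (i : Fin w) => (x i : ℝ)) '' parallelotope lam)

/-- Faces of a discrete parallelotope: the empty set, and the sets of vertices `vertex lam Γ` with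
`Γ₁ ⊆ Γ ⊆ [1,w] \ Γ₀` for disjoint `Γ₀` and `Γ₁`. -/
def IsDiscreteFace (lam : WeightPartition e w) (F : Set (Fin w → ℤ)) : Prop :=
  F = ∅ ∨ ∃ Γ₀ Γ₁ : Finset (Fin w), Disjoint Γ₀ Γ₁ ∧
    F = vertex lam '' {Γ | Γ₁ ⊆ Γ ∧ Disjoint Γ Γ₀}

end Parallelotopes

/-- A vector is `m`-increasing if `x_{i+1} - x_i ≥ m` for all `i`. -/
def IsIncreasing {w : ℕ} (m : ℝ) (x : Fin w → ℝ) : Prop :=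
  ∀ i j : Fin w, (j : ℕ) = (i : ℕ) + 1 → m ≤ x j - x i

/-- The set of `m`-increasing elements of a subset of `ℝ^w`. -/
def increasingPart {w : ℕ} (m : ℝ) (S : Set (Fin w → ℝ)) : Set (Fin w → ℝ) :=
  {x | x ∈ S ∧ IsIncreasing m x}

/-- A partition is `m`-increasing if its label is. -/
def IsIncreasingPartition {e w : ℕ} (m : ℝ) (lam : WeightPartition e w) : Prop :=
  IsIncreasing m fun i => (zLabel lam i : ℝ)

/-! ### Polytopes and polytopal complexes -/

/-- A (possibly empty) polytope: the convex hull of finitely many points. -/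
def IsPolytope {w : ℕ} (P : Set (Fin w → ℝ)) : Prop :=
  ∃ s : Finset (Fin w → ℝ), P = convexHull ℝ (s : Set (Fin w → ℝ))

/-- A face of a polytope `P`: the empty set, or the set of points of `P` at which some linear
functional is maximal (for instance `P` itself, taking the functional `0`). -/
def IsFace {w : ℕ} (P F : Set (Fin w → ℝ)) : Prop := IsExposed ℝ P F

/-- The dimension of a polytope; the empty polytope has dimension `⊥`. -/
noncomputable def polytopeDim {w : ℕ} (P : Set (Fin w → ℝ)) : WithBot ℕ :=
  open Classical in
  if P = ∅ then ⊥ else ((Module.finrank ℝ (affineSpan ℝ P).direction : ℕ) : WithBot ℕ)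

/-- A polytopal complex in `ℝ^w`: a finite collection of polytopes, containing the empty polytope,
closed under taking faces, in which any two members intersect in a common face. -/
structure PolytopalComplex (w : ℕ) where
  cells : Set (Set (Fin w → ℝ))
  finite : cells.Finite
  polytope : ∀ P ∈ cells, IsPolytope P
  empty_mem : ∅ ∈ cells
  face_mem : ∀ P ∈ cells, ∀ F, IsFace P F → F ∈ cells
  inter_face : ∀ P ∈ cells, ∀ Q ∈ cells, IsFace P (P ∩ Q) ∧ IsFace Q (P ∩ Q)

/-- A polytopal complex is pure if every cell is contained in a cell of maximal dimension. -/
def PolytopalComplex.IsPure {w : ℕ} (K : PolytopalComplex w) : Prop :=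
  ∀ P ∈ K.cells, ∃ Q ∈ K.cells, P ⊆ Q ∧ ∀ R ∈ K.cells, polytopeDim R ≤ polytopeDim Q

/-- The `d`-cells of a polytopal complex. -/
def PolytopalComplex.dimCells {w : ℕ} (K : PolytopalComplex w) (d : ℕ) :
    Set (Set (Fin w → ℝ)) :=
  {P | P ∈ K.cells ∧ polytopeDim P = (d : WithBot ℕ)}

end HookQuotient

/-!
The solid parallelotopes of a block are, after one common change of the constant terms, the
subdifferentials of a single convex function at integral points, and this forces any two of them
to meet in a common face.

Fix the core `kappa` and let `q = (q_1 < ... < q_w)` be the starting positions of the movements of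
a partition `lam` of the block.  Let `F` be a function on `ℤ` with slope `zAt e kappa n` between `n`
and `n + 1`; it is convex because the abacus of a core has no vacancy above a bead.  Put
`Φ(q) = ∑ F(q_i) + ∑_{i<k} max(0, q_k - q_i - e)` plus a fixed linear form in `q`.  Subgradients of
the summands assemble to subgradients of `Φ` (`assemble`).

If the positions `q_i` are distinct, then on each runner they are consecutive, and the position of
the pivot is the first vacancy of the runner on the abacus of the core (`startPos_pivot`,
`exists_startPos_eq_add`, `exists_startPos_eq_sub`).  Hence the summands of `Φ` with a kink at `q`
are one for each pivot and one for each pair of neighbours on a runner.  The `w` kinks give a sum of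
`w` segments, whose directions are the vectors `ε_i` up to sign, and a count of vacancies
(`zAt_eq_core_add`) identifies the base point with `z(lam)`.  So the solid parallelotope of `lam`
consists of the vectors assembled from subgradients at `q`, and its vertices come from integral
subgradients (`point_eq_assemble`, `exists_point_eq_assemble`).

Now let `mu` be another partition of the block, with positions `q'`.  A point `x` of the
parallelotope of `lam` satisfies `⟨x, q' - q⟩ ≤ Φ(q') - Φ(q)`.  In case of equality there is
equality in every summand, so the same subgradients are subgradients at `q'` and `x` lies in the
parallelotope of `mu` (`exists_potential`).  With the same inequality for `mu`, the intersection is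
the face of each of the two on which `⟨x, q' - q⟩` is extremal (`isFace_inter`,
`isDiscreteFace_inter`).

The positions are distinct for hook-quotient partitions, since two movements from one position
would give two beads of weight at least `2` on a runner; they are distinct for `10`-increasing
partitions, since `z_i` depends only on `q_i`.  The polytopal complex consists of all faces of the
parallelotopes in question.  There are finitely many because all vertices lie in one box, and the
parallelotopes have dimension `w` because the `ε_i` span `ℝ^w`.
-/

namespace HookQuotient

/-! ### Sliding beads up the abacus -/

/-- The position to which a bead `b` moves when all beads slide as far up their runners as
possible.  The definition makes sense for arbitrary positions `b`, occupied or not. -/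
noncomputable def coreSlot (e : ℕ) (lam : YoungDiagram) (b : ℤ) : ℤ :=
  b - (wt e lam b : ℤ) * (e : ℤ)

theorem vacancies_finite (e : ℕ) (lam : YoungDiagram) (b : ℤ) :
    {x : ℤ | x ∉ beta lam ∧ x < b ∧ x ≡ b [ZMOD (e : ℤ)]}.Finite := by
  refine (Set.finite_Ico (-(lam.colLen 0 : ℤ)) b).subset ?_
  rintro x ⟨hx, hb, -⟩
  refine ⟨?_, hb⟩
  by_contra h
  exact hx (mem_beta_of_lt lam x (by omega))

theorem exists_eq_add_mul {e : ℕ} {x y : ℤ} (h : x ≡ y [ZMOD (e : ℤ)]) :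
    ∃ k : ℤ, y = x + k * e := by
  obtain ⟨k, hk⟩ := h.dvd
  exact ⟨k, by linarith [mul_comm (e : ℤ) k]⟩

theorem add_le_of_modEq {e : ℕ} {x y : ℤ} (h : x ≡ y [ZMOD (e : ℤ)]) (hxy : x < y) :
    x + e ≤ y := by
  have := Int.le_of_dvd (by omega) h.dvd
  omega

theorem modEq_add_self (e : ℕ) (x : ℤ) : x ≡ x + e [ZMOD (e : ℤ)] := by
  simp [Int.modEq_iff_dvd]

theorem wt_add_of_mem {e : ℕ} (he : 2 ≤ e) {lam : YoungDiagram} {x : ℤ} (hx : x ∈ beta lam) :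
    wt e lam (x + e) = wt e lam x := by
  unfold wt
  congr 1
  ext y
  simp only [Set.mem_ofPred_eq]
  constructor
  · rintro ⟨h1, h2, h3⟩
    have h4 : y ≡ x [ZMOD (e : ℤ)] := h3.trans (modEq_add_self e x).symm
    refine ⟨h1, ?_, h4⟩
    rcases lt_trichotomy y x with h | h | h
    · exact h
    · exact absurd (h ▸ hx) h1
    · have := add_le_of_modEq h4.symm h
      omega
  · rintro ⟨h1, h2, h3⟩
    exact ⟨h1, by omega, h3.trans (modEq_add_self e x)⟩

theorem wt_add_of_notMem {e : ℕ} (he : 2 ≤ e) {lam : YoungDiagram} {x : ℤ} (hx : x ∉ beta lam) :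
    wt e lam (x + e) = wt e lam x + 1 := by
  unfold wt
  rw [← Set.ncard_insert_of_notMem (a := x) (by simp) (vacancies_finite e lam x)]
  congr 1
  ext y
  simp only [Set.mem_ofPred_eq, Set.mem_insert_iff]
  constructor
  · rintro ⟨h1, h2, h3⟩
    have h4 : y ≡ x [ZMOD (e : ℤ)] := h3.trans (modEq_add_self e x).symm
    rcases lt_trichotomy y x with h | h | h
    · exact Or.inr ⟨h1, h, h4⟩
    · exact Or.inl h
    · have := add_le_of_modEq h4.symm h
      omega
  · rintro (rfl | ⟨h1, h2, h3⟩)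
    · exact ⟨hx, by omega, modEq_add_self e y⟩
    · exact ⟨h1, by omega, h3.trans (modEq_add_self e x)⟩

theorem coreSlot_add_of_mem {e : ℕ} (he : 2 ≤ e) {lam : YoungDiagram} {x : ℤ}
    (hx : x ∈ beta lam) : coreSlot e lam (x + e) = coreSlot e lam x + e := by
  unfold coreSlot
  rw [wt_add_of_mem he hx]
  ring

theorem coreSlot_add_of_notMem {e : ℕ} (he : 2 ≤ e) {lam : YoungDiagram} {x : ℤ}
    (hx : x ∉ beta lam) : coreSlot e lam (x + e) = coreSlot e lam x := by
  unfold coreSlot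
  rw [wt_add_of_notMem he hx]
  push_cast
  ring

theorem coreSlot_le_add {e : ℕ} (he : 2 ≤ e) (lam : YoungDiagram) (x : ℤ) (n : ℕ) :
    coreSlot e lam x ≤ coreSlot e lam (x + n * e) := by
  induction n with
  | zero => simp
  | succ n ih =>
    have h : x + ((n + 1 : ℕ) : ℤ) * e = (x + n * e) + e := by push_cast; ring
    rw [h]
    by_cases hm : x + n * e ∈ beta lam
    · rw [coreSlot_add_of_mem he hm]; omega
    · rwa [coreSlot_add_of_notMem he hm]

theorem coreSlot_le (e : ℕ) (lam : YoungDiagram) (b : ℤ) : coreSlot e lam b ≤ b := by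
  unfold coreSlot
  have : (0 : ℤ) ≤ (wt e lam b : ℤ) * (e : ℤ) := by positivity
  omega

theorem coreSlot_modEq (e : ℕ) (lam : YoungDiagram) (b : ℤ) :
    coreSlot e lam b ≡ b [ZMOD (e : ℤ)] := by
  simp [coreSlot, Int.modEq_iff_dvd]

/-- Sliding up preserves the order of the beads of a runner. -/
theorem coreSlot_add_le_coreSlot {e : ℕ} (he : 2 ≤ e) {lam : YoungDiagram} {b b' : ℤ}
    (hb : b ∈ beta lam) (hlt : b < b') (hmod : b ≡ b' [ZMOD (e : ℤ)]) :
    coreSlot e lam b + e ≤ coreSlot e lam b' := by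
  have h1 := add_le_of_modEq hmod hlt
  obtain ⟨k, hk⟩ := exists_eq_add_mul ((modEq_add_self e b).symm.trans hmod)
  have he' : (0 : ℤ) < e := by omega
  have hk0 : 0 ≤ k := by
    by_contra h
    have : k * (e : ℤ) < 0 := mul_neg_of_neg_of_pos (by omega) he'
    omega
  lift k to ℕ using hk0
  rw [hk, ← coreSlot_add_of_mem he hb]
  exact coreSlot_le_add he lam _ k

theorem coreSlot_injOn {e : ℕ} (he : 2 ≤ e) (lam : YoungDiagram) :
    Set.InjOn (coreSlot e lam) (beta lam) := by
  intro b hb b' hb' h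
  have hmod : b ≡ b' [ZMOD (e : ℤ)] :=
    (coreSlot_modEq e lam b).symm.trans (h ▸ coreSlot_modEq e lam b')
  rcases lt_trichotomy b b' with hlt | heq | hlt
  · have := coreSlot_add_le_coreSlot he hb hlt hmod
    omega
  · exact heq
  · have := coreSlot_add_le_coreSlot he hb' hlt hmod.symm
    omega

theorem HasCore.mem_iff {e : ℕ} {lam kappa : YoungDiagram} (h : HasCore e lam kappa) {x : ℤ} :
    x ∈ beta kappa ↔ ∃ b ∈ beta lam, coreSlot e lam b = x := by
  rw [h]
  rfl

/-- The abacus of an `e`-core has no vacancy above a bead. -/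
theorem HasCore.sub_mem {e : ℕ} (he : 2 ≤ e) {lam kappa : YoungDiagram}
    (h : HasCore e lam kappa) {x : ℤ} (hx : x ∈ beta kappa) : x - e ∈ beta kappa := by
  obtain ⟨b, -, rfl⟩ := h.mem_iff.1 hx
  rw [h.mem_iff]
  -- The next bead above `b` on its runner ends up directly above `b`.
  have hex : ∃ n : ℕ, b - (n + 1) * e ∈ beta lam := by
    refine ⟨(b + lam.colLen 0).toNat + 1, mem_beta_of_lt _ _ ?_⟩
    have h1 : (b + lam.colLen 0) ≤ ((b + lam.colLen 0).toNat : ℤ) := Int.self_le_toNat _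
    push_cast
    nlinarith
  classical
  have hconst : ∀ k ≤ Nat.find hex, coreSlot e lam (b - k * e) = coreSlot e lam b := by
    intro k
    induction k with
    | zero => simp
    | succ k ih =>
      intro hk
      have h1 := coreSlot_add_of_notMem he (Nat.find_min hex (by omega : k < Nat.find hex))
      rw [show b - ((k : ℤ) + 1) * e + e = b - (k : ℤ) * e by ring, ih (by omega)] at h1
      rw [h1]
      push_cast
      rfl
  refine ⟨_, Nat.find_spec hex, ?_⟩
  have h1 := coreSlot_add_of_mem he (Nat.find_spec hex)
  have h2 := hconst _ le_rfl
  rw [show b - ((Nat.find hex : ℤ) + 1) * e + e = b - (Nat.find hex : ℤ) * e by ring, h2] at h1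
  omega

theorem HasCore.mem_of_le {e : ℕ} (he : 2 ≤ e) {lam kappa : YoungDiagram}
    (h : HasCore e lam kappa) {x y : ℤ} (hy : y ∈ beta kappa) (hxy : x ≤ y)
    (hmod : x ≡ y [ZMOD (e : ℤ)]) : x ∈ beta kappa := by
  obtain ⟨k, hk⟩ := exists_eq_add_mul hmod
  have hk0 : 0 ≤ k := by
    by_contra hneg
    have : k * (e : ℤ) < 0 := mul_neg_of_neg_of_pos (by omega) (by omega)
    omega
  lift k to ℕ using hk0
  obtain rfl : x = y - k * e := by omega
  clear hk hxy hmod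
  induction k with
  | zero => simpa using hy
  | succ k ih =>
    have := h.sub_mem he ih
    rwa [show y - ((k + 1 : ℕ) : ℤ) * e = y - k * e - e by push_cast; ring]

/-! ### Bead movements -/

theorem mem_movements {e : ℕ} (he : 2 ≤ e) {lam : YoungDiagram} {q b : ℤ} :
    toLex (q, b) ∈ movements e lam ↔
      b ∈ beta lam ∧ q ≡ b [ZMOD (e : ℤ)] ∧ coreSlot e lam b < q ∧ q ≤ b := by
  have he' : (0 : ℤ) < e := by omega
  simp only [movements, Finset.mem_biUnion, Finset.mem_image, Finset.mem_range, movableBeads,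
    Set.Finite.mem_toFinset, Set.mem_ofPred_eq, EmbeddingLike.apply_eq_iff_eq, Prod.mk.injEq]
  constructor
  · rintro ⟨b', ⟨hb, -⟩, i, hi, rfl, rfl⟩
    refine ⟨hb, by simp [Int.modEq_iff_dvd], ?_, ?_⟩
    · have : (i : ℤ) * e < (wt e lam b' : ℤ) * e := by
        apply mul_lt_mul_of_pos_right _ he'
        exact_mod_cast hi
      unfold coreSlot
      omega
    · have : (0 : ℤ) ≤ (i : ℤ) * e := by positivity
      omega
  · rintro ⟨hb, hmod, hlt, hle⟩
    obtain ⟨k, hk⟩ := exists_eq_add_mul hmod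
    have hk0 : 0 ≤ k := by
      by_contra hneg
      have : k * (e : ℤ) < 0 := mul_neg_of_neg_of_pos (by omega) he'
      omega
    lift k to ℕ using hk0
    have hkw : k < wt e lam b := by
      unfold coreSlot at hlt
      have : (k : ℤ) * e < (wt e lam b : ℤ) * e := by omega
      exact_mod_cast lt_of_mul_lt_mul_right this he'.le
    exact ⟨b, ⟨hb, by omega⟩, k, hkw, by omega, rfl⟩

section
variable {e w : ℕ}

theorem movement_eq (lam : WeightPartition e w) (i : Fin w) :
    movement lam i = toLex (startPos lam i, bead lam i) := rfl

theorem movement_mem (lam : WeightPartition e w) (i : Fin w) :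
    movement lam i ∈ movements e lam.1 :=
  Finset.orderEmbOfFin_mem _ _ _

theorem bead_spec (he : 2 ≤ e) (lam : WeightPartition e w) (i : Fin w) :
    bead lam i ∈ beta lam.1 ∧ startPos lam i ≡ bead lam i [ZMOD (e : ℤ)] ∧
      coreSlot e lam.1 (bead lam i) < startPos lam i ∧ startPos lam i ≤ bead lam i :=
  (mem_movements he).1 (movement_mem lam i)

theorem exists_movement (he : 2 ≤ e) (lam : WeightPartition e w) {q b : ℤ} (hb : b ∈ beta lam.1)
    (hmod : q ≡ b [ZMOD (e : ℤ)]) (hlt : coreSlot e lam.1 b < q) (hle : q ≤ b) :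
    ∃ i, startPos lam i = q ∧ bead lam i = b := by
  have h : toLex (q, b) ∈ Set.range (movement lam) := by
    rw [show Set.range (movement lam) = movements e lam.1 from Finset.range_orderEmbOfFin _ _]
    exact (mem_movements he).2 ⟨hb, hmod, hlt, hle⟩
  obtain ⟨i, hi⟩ := h
  rw [movement_eq] at hi
  simp only [EmbeddingLike.apply_eq_iff_eq, Prod.mk.injEq] at hi
  exact ⟨i, hi⟩

theorem startPos_mono (lam : WeightPartition e w) : Monotone (startPos lam) := by
  intro i j hij
  have h := (movement lam).monotone hij
  rw [movement_eq, movement_eq, Prod.Lex.toLex_le_toLex] at h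
  rcases h with h | h
  · exact h.le
  · exact h.1.le

theorem countP_two_le_of_isHook (l : List ℕ) (hs : l.SortedGE)
    (hhook : (YoungDiagram.ofRowLens l hs).rowLen 1 ≤ 1) :
    l.countP (fun n => decide (2 ≤ n)) ≤ 1 := by
  have hrow := YoungDiagram.rowLen_ofRowLens (w := l) (hw := hs)
  have hp := hs.pairwise
  match l, hs, hp, hhook, hrow with
  | [], _, _, _, _ => simp
  | [a], _, _, _, _ => exact List.countP_le_length
  | a :: c :: t, _, hp, hhook, hrow =>
    have hc := hrow ⟨1, by simp⟩
    simp only [Fin.getElem_fin, List.getElem_cons_succ, List.getElem_cons_zero] at hc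
    rw [hc] at hhook
    have h0 : (c :: t).countP (fun n => decide (2 ≤ n)) = 0 := by
      rw [List.countP_eq_zero]
      intro n hn
      have : n ≤ 1 := by
        rcases List.mem_cons.1 hn with rfl | hn
        · exact hhook
        · exact ((List.pairwise_cons.1 (List.pairwise_cons.1 hp).2).1 n hn).trans hhook
      simp only [decide_eq_true_eq]
      omega
    rw [List.countP_cons, h0]
    split_ifs <;> omega

/-- If the quotient consists of hooks, no runner has two beads of weight at least `2`, whereas two
movements from the same position would yield two such beads. -/
theorem IsHookQuotient.startPos_injective (he : 2 ≤ e) {lam : WeightPartition e w}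
    (h : IsHookQuotient e lam.1) : Function.Injective (startPos lam) := by
  have key : ∀ i j, startPos lam i = startPos lam j → ¬ bead lam i < bead lam j := by
    intro i j hij hlt
    obtain ⟨hbi, hmi, hci, hli⟩ := bead_spec he lam i
    obtain ⟨hbj, hmj, hcj, hlj⟩ := bead_spec he lam j
    rw [← hij] at hmj hcj hlj
    set x := startPos lam i
    have hmod : bead lam i ≡ bead lam j [ZMOD (e : ℤ)] := hmi.symm.trans hmj
    have h1 := coreSlot_add_le_coreSlot he hbi hlt hmod
    have h2 := add_le_of_modEq hmod hlt
    have h3 := add_le_of_modEq ((coreSlot_modEq e lam.1 (bead lam j)).trans hmj.symm) hcj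
    have he' : (0 : ℤ) < e := by omega
    have hwt : ∀ b, coreSlot e lam.1 b + 2 * e ≤ b → 2 ≤ wt e lam.1 b := by
      intro b hb
      unfold coreSlot at hb
      have : 2 * (e : ℤ) ≤ (wt e lam.1 b : ℤ) * e := by omega
      exact_mod_cast le_of_mul_le_mul_right this he'
    have hwi : 2 ≤ wt e lam.1 (bead lam i) := hwt _ (by omega)
    have hwj : 2 ≤ wt e lam.1 (bead lam j) := hwt _ (by omega)
    have hr0 : 0 ≤ x % e := Int.emod_nonneg _ he'.ne'
    have hr1 : x % e < e := Int.emod_lt_of_pos _ he'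
    have hhook := h (x % e).toNat (by omega)
    have hr : (((x % e).toNat : ℕ) : ℤ) = x % e := Int.toNat_of_nonneg hr0
    have hxr : x ≡ ((x % e).toNat : ℤ) [ZMOD (e : ℤ)] := by
      rw [hr]
      exact (Int.mod_modEq x e).symm
    have hcount : 1 < (quotientParts e lam.1 (x % e).toNat).countP (2 ≤ ·) := by
      unfold quotientParts
      rw [Multiset.countP_map, ← Finset.filter_val]
      refine Finset.one_lt_card.2 ⟨bead lam i, ?_, bead lam j, ?_, hlt.ne⟩ <;>
        simp only [Finset.mem_filter, movableBeads, Set.Finite.mem_toFinset, Set.mem_ofPred_eq]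
      · exact ⟨⟨⟨hbi, by omega⟩, hmi.symm.trans hxr⟩, hwi⟩
      · exact ⟨⟨⟨hbj, by omega⟩, hmj.symm.trans hxr⟩, hwj⟩
    unfold IsHook eQuotient at hhook
    have := countP_two_le_of_isHook _ _ hhook
    rw [← (quotientParts e lam.1 (x % e).toNat).sort_eq (· ≥ ·), Multiset.coe_countP] at hcount
    omega
  intro i j hij
  have hb : bead lam i = bead lam j :=
    le_antisymm (not_lt.1 (key j i hij.symm)) (not_lt.1 (key i j hij))
  apply (movement lam).injective
  rw [movement_eq, movement_eq, hij, hb]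

theorem IsIncreasingPartition.startPos_injective {m : ℝ} (hm : 0 < m) {lam : WeightPartition e w}
    (h : IsIncreasingPartition m lam) : Function.Injective (startPos lam) := by
  have hz : StrictMono fun i => (zLabel lam i : ℝ) := by
    rcases w with _ | w
    · exact fun i => i.elim0
    · rw [Fin.strictMono_iff_lt_succ]
      intro i
      have := h i.castSucc i.succ (by simp)
      simp only at this
      linarith
  intro i j hij
  apply hz.injective
  simp [zLabel, hij]

end

/-! ### Counting vacancies through bead movements -/

section Vacancies
open Classical in
/-- The indicator function of the vacant positions of the abacus. -/
noncomputable def vacancy (lam : YoungDiagram) (x : ℤ) : ℤ := if x ∈ beta lam then 0 else 1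

theorem zAt_eq_sum (e : ℕ) (lam : YoungDiagram) (x : ℤ) :
    (zAt e lam x : ℤ) = ∑ y ∈ Finset.Ioc (x - e) x, vacancy lam y := by
  classical
  have h : {y : ℤ | x - (e : ℤ) < y ∧ y ≤ x ∧ y ∉ beta lam} =
      ((Finset.Ioc (x - e) x).filter fun y => y ∉ beta lam : Finset ℤ) := by
    ext y
    simp [and_assoc]
  unfold zAt
  rw [h, Set.ncard_coe_finset, Finset.card_filter]
  push_cast
  refine Finset.sum_congr rfl fun y _ => ?_
  unfold vacancy
  split_ifs <;> simp_all

theorem zAt_le (e : ℕ) (lam : YoungDiagram) (x : ℤ) : zAt e lam x ≤ e := by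
  have h : (zAt e lam x : ℤ) ≤ ∑ y ∈ Finset.Ioc (x - e) x, 1 := by
    rw [zAt_eq_sum]
    refine Finset.sum_le_sum fun y _ => ?_
    unfold vacancy
    split_ifs <;> simp
  simpa using h

theorem zAt_eq_pred_add (e : ℕ) (lam : YoungDiagram) (x : ℤ) :
    (zAt e lam x : ℤ) = zAt e lam (x - 1) + vacancy lam x - vacancy lam (x - e) := by
  rw [zAt_eq_sum, zAt_eq_sum]
  rcases Nat.eq_zero_or_pos e with rfl | he
  · simp
  have h1 : Finset.Ioc (x - e) x = insert x (Finset.Ioc (x - e) (x - 1)) := by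
    ext y
    simp only [Finset.mem_Ioc, Finset.mem_insert]
    omega
  have h2 : Finset.Ioc (x - 1 - e) (x - 1) = insert (x - e) (Finset.Ioc (x - e) (x - 1)) := by
    ext y
    simp only [Finset.mem_Ioc, Finset.mem_insert]
    omega
  rw [h1, h2, Finset.sum_insert (by simp), Finset.sum_insert (by simp)]
  ring

/-- On the abacus of a core, the number of vacancies in a window of length `e` grows by one when
the window reaches the first vacancy of a runner, and is otherwise constant. -/
theorem HasCore.zAt_eq {e : ℕ} (he : 2 ≤ e) {lam kappa : YoungDiagram}
    (h : HasCore e lam kappa) (x : ℤ) [Decidable (x ∉ beta kappa ∧ x - e ∈ beta kappa)] :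
    (zAt e kappa x : ℤ) =
      zAt e kappa (x - 1) + if x ∉ beta kappa ∧ x - e ∈ beta kappa then 1 else 0 := by
  rw [zAt_eq_pred_add]
  have hs : x ∈ beta kappa → x - e ∈ beta kappa := h.sub_mem he
  unfold vacancy
  split_ifs <;> simp_all

theorem HasCore.zAt_mono {e : ℕ} (he : 2 ≤ e) {lam kappa : YoungDiagram}
    (h : HasCore e lam kappa) : Monotone fun x => (zAt e kappa x : ℤ) := by
  classical
  refine monotone_int_of_le_succ fun x => ?_
  have := h.zAt_eq he (x + 1)
  rw [add_sub_cancel_right] at this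
  rw [this]
  split_ifs <;> simp

end Vacancies

section
variable {e w : ℕ}

open Classical in
/-- Each bead movement vacates the position `q - e` and fills the position `q`. -/
theorem vacancy_eq (he : 2 ≤ e) {lam : WeightPartition e w} {kappa : YoungDiagram}
    (h : HasCore e lam.1 kappa) (x : ℤ) :
    vacancy lam.1 x = vacancy kappa x + (∑ k, if startPos lam k = x + e then 1 else 0) -
      ∑ k, if startPos lam k = x then 1 else 0 := by
  set M : ℤ → Set ℤ := fun x =>
    {b | b ∈ beta lam.1 ∧ x ≡ b [ZMOD (e : ℤ)] ∧ coreSlot e lam.1 b < x ∧ x ≤ b} with hM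
  have hMimage : ∀ x, M x =
      ((Finset.univ.filter fun k => startPos lam k = x).image (bead lam) : Finset ℤ) := by
    intro x
    ext b
    simp only [hM, Set.mem_ofPred_eq, Finset.coe_image, Finset.coe_filter, Finset.mem_univ,
      true_and, Set.mem_image]
    constructor
    · rintro ⟨h1, h2, h3, h4⟩
      exact exists_movement he lam h1 h2 h3 h4
    · rintro ⟨k, rfl, rfl⟩
      exact bead_spec he lam k
  have hcard : ∀ x, ((M x).ncard : ℤ) = ∑ k, if startPos lam k = x then 1 else 0 := by
    intro x
    rw [hMimage, Set.ncard_coe_finset, Finset.card_image_of_injOn, Finset.card_filter]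
    · push_cast
      rfl
    · intro k hk l hl hkl
      simp only [Finset.coe_filter, Finset.mem_univ, true_and, Set.mem_ofPred_eq] at hk hl
      apply (movement lam).injective
      rw [movement_eq, movement_eq, hk, hl, hkl]
  have hfin : ∀ x, (M x).Finite := fun x => by
    rw [hMimage]
    exact Finset.finite_toSet _
  have hfin1 : {b | b ∈ beta lam.1 ∧ b = x}.Finite :=
    (Set.finite_singleton x).subset fun b hb => hb.2
  have hone : (({b | b ∈ beta lam.1 ∧ b = x}).ncard : ℤ) = 1 - vacancy lam.1 x := by
    unfold vacancy
    split_ifs with hx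
    · rw [show {b | b ∈ beta lam.1 ∧ b = x} = {x} by ext; simp; rintro rfl; exact hx]
      simp
    · rw [show {b | b ∈ beta lam.1 ∧ b = x} = ∅ by ext; simp; rintro h1 rfl; exact hx h1]
      simp
  have hsub : {b | b ∈ beta lam.1 ∧ coreSlot e lam.1 b = x}.Subsingleton :=
    fun b hb c hc => coreSlot_injOn he lam.1 hb.1 hc.1 (hb.2.trans hc.2.symm)
  have hcore : (({b | b ∈ beta lam.1 ∧ coreSlot e lam.1 b = x}).ncard : ℤ) =
      1 - vacancy kappa x := by
    unfold vacancy
    split_ifs with hx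
    · obtain ⟨b, hb, hbx⟩ := h.mem_iff.1 hx
      rw [hsub.eq_singleton_of_mem ⟨hb, hbx⟩]
      simp
    · rw [show {b | b ∈ beta lam.1 ∧ coreSlot e lam.1 b = x} = ∅ by
        ext b
        simp only [Set.mem_ofPred_eq, Set.mem_empty_iff_false, iff_false]
        exact fun hb => hx (h.mem_iff.2 ⟨b, hb⟩)]
      simp
  -- Both sides of `hunion` are the set of beads `b` of the runner with `coreSlot b ≤ x ≤ b`.
  have hunion : M (x + e) ∪ {b | b ∈ beta lam.1 ∧ b = x} =
      M x ∪ {b | b ∈ beta lam.1 ∧ coreSlot e lam.1 b = x} := by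
    ext b
    simp only [hM, Set.mem_union, Set.mem_ofPred_eq]
    have hcb := coreSlot_modEq e lam.1 b
    have hle := coreSlot_le e lam.1 b
    constructor
    · rintro (⟨h1, h2, h3, h4⟩ | ⟨h1, rfl⟩)
      · have h5 : x ≡ b [ZMOD (e : ℤ)] := (modEq_add_self e x).trans h2
        rcases lt_trichotomy (coreSlot e lam.1 b) x with h | h | h
        · exact Or.inl ⟨h1, h5, h, by omega⟩
        · exact Or.inr ⟨h1, h⟩
        · have := add_le_of_modEq (h5.trans hcb.symm) h
          omega
      · rcases hle.lt_or_eq with h | h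
        · exact Or.inl ⟨h1, rfl, h, le_rfl⟩
        · exact Or.inr ⟨h1, h⟩
    · have key : b ∈ beta lam.1 → x ≡ b [ZMOD (e : ℤ)] → coreSlot e lam.1 b ≤ x → x ≤ b →
          (b ∈ beta lam.1 ∧ x + e ≡ b [ZMOD (e : ℤ)] ∧ coreSlot e lam.1 b < x + e ∧ x + e ≤ b) ∨
            b ∈ beta lam.1 ∧ b = x := by
        intro h1 h2 h3 h4
        rcases h4.lt_or_eq with h | h
        · exact Or.inl ⟨h1, (modEq_add_self e x).symm.trans h2, by omega, add_le_of_modEq h2 h⟩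
        · exact Or.inr ⟨h1, h.symm⟩
      rintro (⟨h1, h2, h3, h4⟩ | ⟨h1, rfl⟩)
      · exact key h1 h2 h3.le h4
      · exact key h1 hcb le_rfl hle
  have hd1 : Disjoint (M (x + e)) {b | b ∈ beta lam.1 ∧ b = x} := by
    rw [Set.disjoint_left]
    rintro b ⟨-, -, -, h4⟩ ⟨-, rfl⟩
    omega
  have hd2 : Disjoint (M x) {b | b ∈ beta lam.1 ∧ coreSlot e lam.1 b = x} := by
    rw [Set.disjoint_left]
    rintro b ⟨-, -, h3, -⟩ ⟨-, rfl⟩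
    omega
  have hn := congrArg Set.ncard hunion
  rw [Set.ncard_union_eq hd1 (hfin _) hfin1, Set.ncard_union_eq hd2 (hfin _) hsub.finite] at hn
  have hn' := congrArg (Nat.cast : ℕ → ℤ) hn
  push_cast at hn'
  rw [hcard, hcard, hone, hcore] at hn'
  linarith

theorem zAt_eq_core_add (he : 2 ≤ e) {lam : WeightPartition e w} {kappa : YoungDiagram}
    (h : HasCore e lam.1 kappa) (x : ℤ) :
    (zAt e lam.1 x : ℤ) = zAt e kappa x +
      (∑ k, if x < startPos lam k ∧ startPos lam k ≤ x + e then 1 else 0) -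
      ∑ k, if x - e < startPos lam k ∧ startPos lam k ≤ x then 1 else 0 := by
  classical
  rw [zAt_eq_sum, zAt_eq_sum, Finset.sum_congr rfl fun y _ => vacancy_eq he h y]
  rw [Finset.sum_sub_distrib, Finset.sum_add_distrib]
  congr 1
  · congr 1
    rw [Finset.sum_comm]
    refine Finset.sum_congr rfl fun k _ => ?_
    simp only [← sub_eq_iff_eq_add]
    rw [Finset.sum_ite_eq]
    refine if_congr ?_ rfl rfl
    simp only [Finset.mem_Ioc]
    omega
  · rw [Finset.sum_comm]
    refine Finset.sum_congr rfl fun k _ => ?_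
    rw [Finset.sum_ite_eq]
    simp only [Finset.mem_Ioc]

/-! ### The movements of one runner -/

theorem mem_sameRunner {lam : WeightPartition e w} {i k : Fin w} :
    k ∈ sameRunner lam i ↔ startPos lam k ≡ startPos lam i [ZMOD (e : ℤ)] := by
  simp [sameRunner]

theorem sameRunner_eq {lam : WeightPartition e w} {i k : Fin w}
    (h : startPos lam k ≡ startPos lam i [ZMOD (e : ℤ)]) :
    sameRunner lam k = sameRunner lam i := by
  ext l
  rw [mem_sameRunner, mem_sameRunner]
  exact ⟨fun h' => h'.trans h, fun h' => h'.trans h.symm⟩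

theorem pivot_eq {lam : WeightPartition e w} {i k : Fin w}
    (h : startPos lam k ≡ startPos lam i [ZMOD (e : ℤ)]) : pivot lam k = pivot lam i := by
  unfold pivot lastOnRunner
  congr 2 <;> simp only [sameRunner_eq h]

theorem startPos_pivot_modEq (lam : WeightPartition e w) (i : Fin w) :
    startPos lam (pivot lam i) ≡ startPos lam i [ZMOD (e : ℤ)] :=
  mem_sameRunner.1 (pivot_mem lam i)

/-- The pivot of a runner starts at the first vacancy of that runner on the abacus of the core. -/
theorem startPos_pivot (he : 2 ≤ e) {lam : WeightPartition e w} {kappa : YoungDiagram}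
    (h : HasCore e lam.1 kappa) (i : Fin w) :
    startPos lam (pivot lam i) ∉ beta kappa ∧ startPos lam (pivot lam i) - e ∈ beta kappa := by
  set L := lastOnRunner lam i with hL
  set b := bead lam L with hb
  have hLmem : startPos lam L ≡ startPos lam i [ZMOD (e : ℤ)] :=
    mem_sameRunner.1 (Finset.max'_mem _ _)
  have hmax : ∀ k, startPos lam k ≡ startPos lam i [ZMOD (e : ℤ)] →
      startPos lam k ≤ startPos lam L :=
    fun k hk => startPos_mono lam (Finset.le_max' _ _ (mem_sameRunner.2 hk))
  obtain ⟨h1, h2, h3, h4⟩ := bead_spec he lam L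
  rw [← hb] at h1 h2 h3 h4
  have hbi : b ≡ startPos lam i [ZMOD (e : ℤ)] := h2.symm.trans hLmem
  -- All movable beads of the runner are at most `b`.
  have htop : ∀ c ∈ beta lam.1, c ≡ b [ZMOD (e : ℤ)] → coreSlot e lam.1 c < c → c ≤ b := by
    intro c hc hcb hlt
    obtain ⟨k, hk, -⟩ := exists_movement he lam hc rfl hlt le_rfl
    have := hmax k (hk ▸ hcb.trans hbi)
    omega
  have hcb := coreSlot_modEq e lam.1 b
  have hstep : coreSlot e lam.1 b + e ≤ b := add_le_of_modEq hcb (by omega)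
  obtain ⟨p, hp, hpb⟩ := exists_movement he lam (q := coreSlot e lam.1 b + e) h1
    ((modEq_add_self e _).symm.trans hcb) (by omega) hstep
  have hpmem : p ∈ (sameRunner lam i).filter fun k => bead lam k = b := by
    refine Finset.mem_filter.2 ⟨mem_sameRunner.2 ?_, hpb⟩
    rw [hp]
    exact ((modEq_add_self e _).symm.trans hcb).trans hbi
  have hle : startPos lam (pivot lam i) ≤ coreSlot e lam.1 b + e :=
    hp ▸ startPos_mono lam (Finset.min'_le _ _ hpmem)
  have hpiv := bead_spec he lam (pivot lam i)
  rw [show bead lam (pivot lam i) = b from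
    (Finset.mem_filter.1 (Finset.min'_mem _ (finalMoves_nonempty lam i))).2] at hpiv
  have hge := add_le_of_modEq (hcb.trans hpiv.2.1.symm) hpiv.2.2.1
  rw [le_antisymm hle hge]
  refine ⟨fun hmem => ?_, ?_⟩
  · obtain ⟨c, hc, hcc⟩ := h.mem_iff.1 hmem
    have hcmod : c ≡ b [ZMOD (e : ℤ)] := by
      have := coreSlot_modEq e lam.1 c
      rw [hcc] at this
      exact this.symm.trans ((modEq_add_self e _).symm.trans hcb)
    have hbc : b < c := by
      rcases lt_trichotomy b c with hlt | rfl | hlt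
      · exact hlt
      · omega
      · have := coreSlot_add_le_coreSlot he hc hlt hcmod
        omega
    have := htop c hc hcmod (by omega)
    omega
  · rw [add_sub_cancel_right]
    exact h.mem_iff.2 ⟨b, h1, rfl⟩

theorem HasCore.eq_of_firstVacancy (he : 2 ≤ e) {lam kappa : YoungDiagram}
    (h : HasCore e lam kappa) {x y : ℤ} (hmod : x ≡ y [ZMOD (e : ℤ)]) (hx : x ∉ beta kappa)
    (hx' : x - e ∈ beta kappa) (hy : y ∉ beta kappa) (hy' : y - e ∈ beta kappa) : x = y := by
  have key : ∀ x y : ℤ, x ≡ y [ZMOD (e : ℤ)] → x ∉ beta kappa → y - e ∈ beta kappa → y ≤ x := by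
    intro x y hmod hx hy
    by_contra hlt
    have := add_le_of_modEq hmod (not_le.1 hlt)
    refine hx (h.mem_of_le he hy (by omega) (hmod.trans ?_))
    simp [Int.modEq_iff_dvd]
  exact le_antisymm (key y x hmod.symm hy hx') (key x y hmod hx hy')

theorem eq_pivot_iff (he : 2 ≤ e) {lam : WeightPartition e w} {kappa : YoungDiagram}
    (h : HasCore e lam.1 kappa) (hq : Function.Injective (startPos lam)) (i : Fin w) :
    i = pivot lam i ↔ startPos lam i ∉ beta kappa ∧ startPos lam i - e ∈ beta kappa := by
  have hp := startPos_pivot he h i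
  constructor
  · intro hi
    rwa [← hi] at hp
  · rintro ⟨h1, h2⟩
    exact hq (h.eq_of_firstVacancy he (startPos_pivot_modEq lam i).symm h1 h2 hp.1 hp.2)

/-- Above the pivot the movements of a runner start from consecutive positions. -/
theorem exists_startPos_eq_add (he : 2 ≤ e) {lam : WeightPartition e w} {kappa : YoungDiagram}
    (h : HasCore e lam.1 kappa) (hq : Function.Injective (startPos lam)) {i : Fin w}
    (hi : i < pivot lam i) : ∃ k, startPos lam k = startPos lam i + e := by
  have hp := startPos_pivot he h i
  have hmodp := startPos_pivot_modEq lam i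
  have hlt : startPos lam i < startPos lam (pivot lam i) :=
    ((startPos_mono lam).strictMono_of_injective hq) hi
  have hle := add_le_of_modEq hmodp.symm hlt
  have hmem : startPos lam i ∈ beta kappa := by
    refine h.mem_of_le he hp.2 (by omega) (hmodp.symm.trans ?_)
    simp [Int.modEq_iff_dvd]
  obtain ⟨h1, h2, h3, h4⟩ := bead_spec he lam i
  have hmod' : ∀ {c}, startPos lam i ≡ c [ZMOD (e : ℤ)] → startPos lam i + e ≡ c [ZMOD (e : ℤ)] :=
    fun hc => (modEq_add_self e _).symm.trans hc
  rcases h4.lt_or_eq with h4 | h4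
  · obtain ⟨k, hk, -⟩ := exists_movement he lam h1 (hmod' h2) (by omega) (add_le_of_modEq h2 h4)
    exact ⟨k, hk⟩
  · obtain ⟨c, hc, hcc⟩ := h.mem_iff.1 hmem
    have hcle := coreSlot_le e lam.1 c
    have hcm := coreSlot_modEq e lam.1 c
    rw [hcc] at hcle hcm
    have hne : startPos lam i ≠ c := by
      intro heq
      rw [← h4, heq] at h3
      omega
    obtain ⟨k, hk, -⟩ := exists_movement he lam hc (hmod' hcm) (by omega)
      (add_le_of_modEq hcm (lt_of_le_of_ne hcle hne))
    exact ⟨k, hk⟩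

/-- Below the pivot the movements of a runner start from consecutive positions. -/
theorem exists_startPos_eq_sub (he : 2 ≤ e) {lam : WeightPartition e w} {kappa : YoungDiagram}
    (h : HasCore e lam.1 kappa) (hq : Function.Injective (startPos lam)) {i : Fin w}
    (hi : pivot lam i < i) : ∃ k, startPos lam k = startPos lam i - e := by
  have hp := startPos_pivot he h i
  have hmodp := startPos_pivot_modEq lam i
  have hlt : startPos lam (pivot lam i) < startPos lam i :=
    ((startPos_mono lam).strictMono_of_injective hq) hi
  have hle := add_le_of_modEq hmodp hlt
  have hsub : startPos lam i - e ≡ startPos lam i [ZMOD (e : ℤ)] := by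
    simp [Int.modEq_iff_dvd]
  have hmem : startPos lam i - e ∉ beta kappa := fun hm =>
    hp.1 (h.mem_of_le he hm (by omega) (hmodp.trans hsub.symm))
  obtain ⟨h1, h2, h3, h4⟩ := bead_spec he lam i
  have h5 := add_le_of_modEq ((coreSlot_modEq e lam.1 _).trans h2.symm) h3
  have hne : coreSlot e lam.1 (bead lam i) ≠ startPos lam i - e := fun heq =>
    hmem (h.mem_iff.2 ⟨_, h1, heq⟩)
  obtain ⟨k, hk, -⟩ := exists_movement he lam h1 (hsub.trans h2) (by omega) (by omega)
  exact ⟨k, hk⟩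

/-- The coordinates of the modified basis vectors. -/
theorem modBasis_apply (he : 2 ≤ e) {lam : WeightPartition e w} {kappa : YoungDiagram}
    (h : HasCore e lam.1 kappa) (hq : Function.Injective (startPos lam)) (k i : Fin w) :
    modBasis lam k i = (if k = i then 1 else 0) -
      (if k < pivot lam k ∧ startPos lam i = startPos lam k + e then 1 else 0) -
      (if pivot lam k < k ∧ startPos lam k = startPos lam i + e then 1 else 0) := by
  have hmono := (startPos_mono lam).strictMono_of_injective hq
  unfold modBasis
  by_cases h1 : k < pivot lam k
  · rw [dif_pos h1]
    simp only [Pi.sub_apply, Pi.single_apply, eq_comm (a := i) (b := k)]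
    obtain ⟨n, hn⟩ := exists_startPos_eq_add he h hq h1
    have hmin : ((sameRunner lam k).filter fun l => k < l).min'
        ⟨pivot lam k, Finset.mem_filter.mpr ⟨pivot_mem lam k, h1⟩⟩ = n := by
      refine le_antisymm (Finset.min'_le _ _ ?_) (Finset.le_min' _ _ _ fun l hl => ?_)
      · refine Finset.mem_filter.2 ⟨mem_sameRunner.2 ?_, hmono.lt_iff_lt.1 (by omega)⟩
        rw [hn]
        exact (modEq_add_self e _).symm
      · obtain ⟨hl, hkl⟩ := Finset.mem_filter.1 hl
        rw [← hmono.le_iff_le, hn]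
        exact add_le_of_modEq (mem_sameRunner.1 hl).symm (hmono hkl)
    rw [hmin, ← hn]
    simp [h1, h1.not_gt, hq.eq_iff]
  rw [dif_neg h1]
  by_cases h2 : pivot lam k < k
  · rw [dif_pos h2]
    simp only [Pi.sub_apply, Pi.single_apply, eq_comm (a := i) (b := k)]
    obtain ⟨n, hn⟩ := exists_startPos_eq_sub he h hq h2
    have hmax : ((sameRunner lam k).filter fun l => l < k).max'
        ⟨pivot lam k, Finset.mem_filter.mpr ⟨pivot_mem lam k, h2⟩⟩ = n := by
      refine le_antisymm (Finset.max'_le _ _ _ fun l hl => ?_) (Finset.le_max' _ _ ?_)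
      · obtain ⟨hl, hkl⟩ := Finset.mem_filter.1 hl
        rw [← hmono.le_iff_le, hn]
        have := add_le_of_modEq (mem_sameRunner.1 hl) (hmono hkl)
        omega
      · refine Finset.mem_filter.2 ⟨mem_sameRunner.2 ?_, hmono.lt_iff_lt.1 (by omega)⟩
        rw [hn]
        simp [Int.modEq_iff_dvd]
    have hiff : startPos lam k = startPos lam i + e ↔ i = n := by
      rw [← hq.eq_iff, hn]
      omega
    rw [hmax]
    simp [h1, h2, hiff]
  · rw [dif_neg h2]
    simp [h1, h2, Pi.single_apply, eq_comm (a := i) (b := k)]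

end

/-! ### Convex potentials on `ℤ` -/

theorem exists_primitive (f : ℤ → ℝ) : ∃ F : ℤ → ℝ, ∀ n, F (n + 1) = F n + f n := by
  refine ⟨fun n => ∑ k ∈ Finset.Ico 0 n, f k - ∑ k ∈ Finset.Ico n 0, f k, fun n => ?_⟩
  beta_reduce
  rcases le_or_gt 0 n with hn | hn
  · rw [Finset.Ico_eq_empty (a := n + 1) (by omega), Finset.Ico_eq_empty (a := n) (by omega),
      show Finset.Ico 0 (n + 1) = insert n (Finset.Ico 0 n) by
        ext; simp only [Finset.mem_Ico, Finset.mem_insert]; omega,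
      Finset.sum_insert (by simp)]
    simp [add_comm]
  · rw [Finset.Ico_eq_empty (b := n + 1) (by omega), Finset.Ico_eq_empty (b := n) (by omega),
      show Finset.Ico n 0 = insert n (Finset.Ico (n + 1) 0) by
        ext; simp only [Finset.mem_Ico, Finset.mem_insert]; omega,
      Finset.sum_insert (by simp)]
    simp

/-- A slope between the left and the right slope at `n` is a subgradient at `n`. -/
theorem subgradient_le {f F : ℤ → ℝ} (hf : Monotone f) (hF : ∀ n, F (n + 1) = F n + f n)
    {n : ℤ} {s : ℝ} (h1 : f (n - 1) ≤ s) (h2 : s ≤ f n) (m : ℤ) :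
    s * ((m : ℝ) - n) ≤ F m - F n := by
  rcases le_total n m with h | h
  · obtain ⟨k, rfl⟩ := Int.le.dest h
    clear h
    induction k with
    | zero => simp
    | succ k ih =>
      have h3 := hF (n + k)
      have h4 : f n ≤ f (n + k) := hf (by omega)
      rw [show n + ((k + 1 : ℕ) : ℤ) = n + k + 1 by push_cast; ring]
      push_cast at ih ⊢
      linarith
  · obtain ⟨k, rfl⟩ := Int.le.dest h
    clear h
    induction k generalizing m with
    | zero => simp
    | succ k ih =>
      have h5 : m + ((k + 1 : ℕ) : ℤ) = m + 1 + k := by push_cast; ring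
      rw [h5] at h1 h2 ⊢
      have h3 := hF m
      have h4 : f m ≤ f (m + 1 + k - 1) := hf (by omega)
      have := ih (m + 1) h1 h2
      push_cast at this ⊢
      linarith

/-- A subgradient at `n` whose supporting line also touches at `m` is a subgradient at `m`. -/
theorem subgradient_of_eq {f F : ℤ → ℝ} (hf : Monotone f) (hF : ∀ n, F (n + 1) = F n + f n)
    {n m : ℤ} {s : ℝ} (h1 : f (n - 1) ≤ s) (h2 : s ≤ f n)
    (h : F m - F n - s * ((m : ℝ) - n) = 0) : f (m - 1) ≤ s ∧ s ≤ f m := by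
  have h3 := subgradient_le hf hF h1 h2 (m - 1)
  have h4 := subgradient_le hf hF h1 h2 (m + 1)
  have h5 := hF (m - 1)
  have h6 := hF m
  rw [sub_add_cancel] at h5
  push_cast at h3 h4
  constructor <;> linarith

section
variable {e w : ℕ}

/-! ### The solid parallelotope as a subdifferential -/

/-- The point `z(lam) + ∑ t_k ε_k`. -/
noncomputable def point (lam : WeightPartition e w) (t : Fin w → ℝ) : Fin w → ℝ :=
  fun i => (zLabel lam i : ℝ) + ∑ k, t k * (modBasis lam k i : ℝ)

theorem vertex_cast (lam : WeightPartition e w) (Γ : Finset (Fin w)) :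
    (fun i => (vertex lam Γ i : ℝ)) = point lam fun k => if k ∈ Γ then 1 else 0 := by
  ext i
  simp [vertex, point, Finset.sum_apply]

theorem solidParallelotope_eq (lam : WeightPartition e w) :
    solidParallelotope lam = point lam '' {t | ∀ k, 0 ≤ t k ∧ t k ≤ 1} := by
  classical
  let v : Fin w → Fin w → ℝ := fun k i => modBasis lam k i
  let f : (Fin w → ℝ) →ᵃ[ℝ] (Fin w → ℝ) :=
    (Fintype.linearCombination ℝ v).toAffineMap +
      AffineMap.const ℝ (Fin w → ℝ) (fun i => (zLabel lam i : ℝ))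
  have hf : ⇑f = point lam := by
    ext t i
    simp [f, point, v, Fintype.linearCombination_apply, Finset.sum_apply, add_comm]
  have hcube : {t : Fin w → ℝ | ∀ k, 0 ≤ t k ∧ t k ≤ 1} =
      convexHull ℝ (Set.univ.pi fun _ : Fin w => ({0, 1} : Set ℝ)) := by
    rw [convexHull_pi]
    ext t
    simp only [convexHull_pair, segment_eq_Icc zero_le_one, Set.mem_pi, Set.mem_univ, true_imp_iff,
      Set.mem_Icc, Set.mem_ofPred_eq]
  rw [hcube, ← hf, AffineMap.image_convexHull, hf]
  unfold solidParallelotope parallelotope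
  congr 1
  ext x
  constructor
  · rintro ⟨_, ⟨Γ, rfl⟩, rfl⟩
    refine ⟨fun k => if k ∈ Γ then 1 else 0, fun k _ => ?_, (vertex_cast lam Γ).symm⟩
    by_cases hk : k ∈ Γ <;> simp [hk]
  · rintro ⟨t, ht, rfl⟩
    refine ⟨_, ⟨Finset.univ.filter fun k => t k = 1, rfl⟩, ?_⟩
    refine (vertex_cast lam _).trans ?_
    congr 1
    ext k
    rcases ht k trivial with h | h
    · simp [h]
    · simp [Set.mem_singleton_iff.1 h]

theorem mem_parallelotope_iff (lam : WeightPartition e w) (x : Fin w → ℤ) :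
    x ∈ parallelotope lam ↔ ∃ t : Fin w → ℝ, (∀ k, t k = 0 ∨ t k = 1) ∧
      point lam t = fun i => (x i : ℝ) := by
  classical
  constructor
  · rintro ⟨Γ, rfl⟩
    refine ⟨fun k => if k ∈ Γ then 1 else 0, fun k => ?_, (vertex_cast lam Γ).symm⟩
    by_cases hk : k ∈ Γ <;> simp [hk]
  · rintro ⟨t, ht, htx⟩
    refine ⟨Finset.univ.filter fun k => t k = 1, ?_⟩
    have h : (fun i => (vertex lam (Finset.univ.filter fun k => t k = 1) i : ℝ)) =
        fun i => (x i : ℝ) := by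
      rw [vertex_cast, ← htx]
      congr 1
      ext k
      rcases ht k with h | h <;> simp [h]
    ext i
    exact_mod_cast congrFun h i

/-- The unit step at `e`, the slope of `d ↦ max 0 (d - e)` to the right of an integer. -/
def unitStep (e : ℕ) (d : ℤ) : ℝ := if (e : ℤ) ≤ d then 1 else 0

theorem unitStep_mono (e : ℕ) : Monotone (unitStep e) := by
  intro a b hab
  unfold unitStep
  split_ifs <;> first | omega | norm_num

/-- The data `u`, `r` consist of a subgradient at `q i` of the potential with slopes
`zAt e kappa`, for every `i`, and a subgradient at `q k - q i` of the potential with slopes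
`unitStep e`, for all `i < k`. -/
def IsSubgradientData (e : ℕ) (kappa : YoungDiagram) (q : Fin w → ℤ) (u : Fin w → ℝ)
    (r : Fin w → Fin w → ℝ) : Prop :=
  (∀ i, (zAt e kappa (q i - 1) : ℝ) ≤ u i ∧ u i ≤ zAt e kappa (q i)) ∧
    ∀ i k, i < k → unitStep e (q k - q i - 1) ≤ r i k ∧ r i k ≤ unitStep e (q k - q i)

/-- The subgradient assembled from the subgradients of the summands.  The constants
`w - 2 i - 1` contribute a linear term to the potential. -/
noncomputable def assemble (u : Fin w → ℝ) (r : Fin w → Fin w → ℝ) : Fin w → ℝ :=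
  fun i => u i + (∑ k, if k < i then r k i else 0) - (∑ k, if i < k then r i k else 0) +
    ((w : ℝ) - 2 * (i : ℝ) - 1)

/-- The subgradients at the positions of the movements that belong to the point `point lam t`. -/
noncomputable def soloCoeff (lam : WeightPartition e w) (kappa : YoungDiagram) (t : Fin w → ℝ)
    (i : Fin w) : ℝ :=
  zAt e kappa (startPos lam i - 1) + if i = pivot lam i then t i else 0

/-- The subgradients at the differences of the positions of the movements that belong to the point
`point lam t`. -/
noncomputable def pairCoeff (lam : WeightPartition e w) (t : Fin w → ℝ) (i k : Fin w) : ℝ :=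
  if startPos lam k = startPos lam i + e then
    if i < pivot lam i then 1 - t i else t k
  else unitStep e (startPos lam k - startPos lam i)

theorem pivot_eq_of_add {lam : WeightPartition e w} {i k : Fin w}
    (h : startPos lam k = startPos lam i + e) : pivot lam k = pivot lam i :=
  pivot_eq (h ▸ (modEq_add_self e _).symm)

theorem lt_pivot_iff_of_add {lam : WeightPartition e w} (he : 2 ≤ e)
    (hq : Function.Injective (startPos lam)) {i k : Fin w}
    (h : startPos lam k = startPos lam i + e) : i < pivot lam i ↔ k ≤ pivot lam k := by
  have hmono := (startPos_mono lam).strictMono_of_injective hq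
  rw [pivot_eq_of_add h, ← hmono.lt_iff_lt, ← hmono.le_iff_le, h]
  exact ⟨fun hlt => add_le_of_modEq (startPos_pivot_modEq lam i).symm hlt, fun hle => by omega⟩

theorem sum_ite_lt_sub (i : Fin w) :
    (∑ k : Fin w, if i < k then (1 : ℝ) else 0) - (∑ k : Fin w, if k < i then (1 : ℝ) else 0) =
      (w : ℝ) - 2 * (i : ℝ) - 1 := by
  rw [Finset.sum_boole, Finset.sum_boole]
  have h1 : (Finset.univ.filter fun k => i < k) = Finset.Ioi i := by ext; simp
  have h2 : (Finset.univ.filter fun k => k < i) = Finset.Iio i := by ext; simp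
  rw [h1, h2, Fin.card_Ioi, Fin.card_Iio]
  have := i.isLt
  rw [Nat.sub_sub, Nat.cast_sub (by omega)]
  push_cast
  ring

theorem sum_boole_startPos {lam : WeightPartition e w} (hq : Function.Injective (startPos lam))
    {p : Prop} [Decidable p] {x : ℤ} (h : p → ∃ k, startPos lam k = x) :
    (∑ k, if startPos lam k = x ∧ p then (1 : ℝ) else 0) = if p then 1 else 0 := by
  by_cases hp : p
  · obtain ⟨k, rfl⟩ := h hp
    simp [hp, hq.eq_iff]
  · simp [hp]

theorem cast_zLabel (he : 2 ≤ e) {lam : WeightPartition e w} {kappa : YoungDiagram}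
    (h : HasCore e lam.1 kappa) (hq : Function.Injective (startPos lam)) (i : Fin w) :
    (zLabel lam i : ℝ) = zAt e kappa (startPos lam i - 1) + (if i = pivot lam i then 1 else 0) +
      (∑ k, if startPos lam i < startPos lam k ∧ startPos lam k ≤ startPos lam i + e
        then 1 else 0) -
      ∑ k, if startPos lam i - e < startPos lam k ∧ startPos lam k ≤ startPos lam i
        then 1 else 0 := by
  classical
  have h1 := zAt_eq_core_add he h (startPos lam i)
  rw [h.zAt_eq he, if_congr (eq_pivot_iff he h hq i).symm rfl rfl] at h1
  unfold zLabel
  rw [h1]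
  push_cast
  rfl

theorem point_eq_assemble (he : 2 ≤ e) {lam : WeightPartition e w} {kappa : YoungDiagram}
    (h : HasCore e lam.1 kappa) (hq : Function.Injective (startPos lam)) (t : Fin w → ℝ) :
    point lam t = assemble (soloCoeff lam kappa t) (pairCoeff lam t) := by
  have hmono := (startPos_mono lam).strictMono_of_injective hq
  ext i
  unfold point assemble
  rw [cast_zLabel he h hq, ← sum_ite_lt_sub]
  -- The contributions of the index `k` on both sides differ only for `k` equal or adjacent to `i`.
  have hterm : ∀ k, (if startPos lam i < startPos lam k ∧ startPos lam k ≤ startPos lam i + e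
        then (1 : ℝ) else 0) -
      (if startPos lam i - e < startPos lam k ∧ startPos lam k ≤ startPos lam i
        then 1 else 0) + t k * (modBasis lam k i : ℝ) -
      (if k < i then pairCoeff lam t k i else 0) + (if i < k then pairCoeff lam t i k else 0) -
      (if i < k then 1 else 0) + (if k < i then 1 else 0) =
      (1 - t i) * ((if startPos lam k = startPos lam i + e ∧ i < pivot lam i then 1 else 0) +
        (if startPos lam k = startPos lam i - e ∧ pivot lam i < i then 1 else 0) -
        (if k = i then 1 else 0)) := by
    intro k
    rw [modBasis_apply he h hq]
    push_cast
    simp only [pairCoeff, unitStep]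
    rcases lt_trichotomy i k with hik | rfl | hik
    · have hlt := hmono hik
      have f1 : ¬ startPos lam k ≤ startPos lam i := by omega
      have f2 : ¬ startPos lam i = startPos lam k + e := by omega
      have f3 : ¬ startPos lam k = startPos lam i - e := by omega
      rcases lt_trichotomy (startPos lam k) (startPos lam i + e) with hd | hd | hd
      · have f4 : startPos lam k ≤ startPos lam i + e := by omega
        have f5 : ¬ startPos lam k = startPos lam i + e := by omega
        have f6 : ¬ (e : ℤ) ≤ startPos lam k - startPos lam i := by omega
        simp only [hik, hik.not_gt, hik.ne', hlt, f1, f2, f3, f4, f5, f6, and_true, and_false,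
          false_and, if_true, if_false]
        ring
      · have f4 : startPos lam k ≤ startPos lam i + e := by omega
        have hp := lt_pivot_iff_of_add he hq hd
        by_cases hip : i < pivot lam i
        · simp only [hik, hik.not_gt, hik.ne', hlt, f1, f2, f3, f4, eq_true hd, hip,
            (hp.1 hip).not_gt, and_true, and_false, false_and, if_true, if_false]
          ring
        · have hkp : pivot lam k < k := not_le.1 fun hle => hip (hp.2 hle)
          simp only [hik, hik.not_gt, hik.ne', hlt, f1, f2, f3, f4, eq_true hd, hip,
            hkp, and_true, and_false, false_and, if_true, if_false]
          ring
      · have f4 : ¬ startPos lam k ≤ startPos lam i + e := by omega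
        have f5 : ¬ startPos lam k = startPos lam i + e := by omega
        have f6 : (e : ℤ) ≤ startPos lam k - startPos lam i := by omega
        simp only [hik, hik.not_gt, hik.ne', f1, f2, f3, f4, f5, f6, and_false,
          false_and, if_true, if_false]
        ring
    · have f1 : ¬ startPos lam i = startPos lam i + e := by omega
      have f2 : ¬ startPos lam i = startPos lam i - e := by omega
      have f3 : startPos lam i - e < startPos lam i := by omega
      simp only [f1, f2, f3, lt_irrefl, le_refl, and_true, and_false, false_and, if_true, if_false]
      ring
    · have hlt := hmono hik
      have f1 : ¬ startPos lam i < startPos lam k := by omega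
      have f2 : ¬ startPos lam k = startPos lam i + e := by omega
      have f3 : startPos lam k ≤ startPos lam i := by omega
      rcases lt_trichotomy (startPos lam i) (startPos lam k + e) with hd | hd | hd
      · have f4 : startPos lam i - e < startPos lam k := by omega
        have f5 : ¬ startPos lam i = startPos lam k + e := by omega
        have f6 : ¬ (e : ℤ) ≤ startPos lam i - startPos lam k := by omega
        have f7 : ¬ startPos lam k = startPos lam i - e := by omega
        simp only [hik, hik.not_gt, hik.ne, f1, f2, f3, f4, f5, f6, f7, and_true, and_false,
          false_and, if_true, if_false]
        ring
      · have f4 : ¬ startPos lam i - e < startPos lam k := by omega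
        have f7 : startPos lam k = startPos lam i - e := by omega
        have hp := lt_pivot_iff_of_add he hq hd
        by_cases hkp : k < pivot lam k
        · simp only [hik, hik.not_gt, hik.ne, f1, f2, f3, f4, eq_true hd, eq_true f7, hkp,
            (hp.1 hkp).not_gt, and_true, and_false, false_and, if_true, if_false]
          ring
        · have hip : pivot lam i < i := not_le.1 fun hle => hkp (hp.2 hle)
          simp only [hik, hik.not_gt, hik.ne, f1, f2, f3, f4, eq_true hd, eq_true f7, hkp,
            hip, and_true, and_false, false_and, if_true, if_false]
          ring
      · have f4 : ¬ startPos lam i - e < startPos lam k := by omega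
        have f5 : ¬ startPos lam i = startPos lam k + e := by omega
        have f6 : (e : ℤ) ≤ startPos lam i - startPos lam k := by omega
        have f7 : ¬ startPos lam k = startPos lam i - e := by omega
        simp only [hik, hik.not_gt, hik.ne, f1, f2, f4, f5, f6, f7, and_false,
          false_and, if_true, if_false]
        ring
  have hsum := Finset.sum_congr (rfl : (Finset.univ : Finset (Fin w)) = _) fun k _ => hterm k
  rw [← Finset.mul_sum] at hsum
  simp only [Finset.sum_add_distrib, Finset.sum_sub_distrib] at hsum
  rw [sum_boole_startPos hq (fun hi => exists_startPos_eq_add he h hq hi),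
    sum_boole_startPos hq (fun hi => exists_startPos_eq_sub he h hq hi),
    Finset.sum_ite_eq' Finset.univ i, if_pos (Finset.mem_univ i)] at hsum
  unfold soloCoeff
  rcases lt_trichotomy i (pivot lam i) with hi | hi | hi
  · rw [if_pos hi, if_neg hi.not_gt] at hsum
    rw [if_neg hi.ne, if_neg hi.ne]
    linarith
  · rw [if_neg hi.not_lt, if_neg hi.not_gt] at hsum
    rw [if_pos hi, if_pos hi]
    linarith
  · rw [if_neg hi.not_gt, if_pos hi] at hsum
    rw [if_neg hi.ne', if_neg hi.ne']
    linarith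

/-- The coefficients in `Z` between `0` and `1`: all of `[0, 1]` for `Z = ⊤`, and `{0, 1}` when `Z`
is the group of integers. -/
def cube (w : ℕ) (Z : AddSubgroup ℝ) : Set (Fin w → ℝ) :=
  {t | ∀ k, t k ∈ Z ∧ 0 ≤ t k ∧ t k ≤ 1}

theorem isSubgradientData_of_mem_cube (he : 2 ≤ e) {lam : WeightPartition e w}
    {kappa : YoungDiagram} (h : HasCore e lam.1 kappa) (hq : Function.Injective (startPos lam))
    {Z : AddSubgroup ℝ} {t : Fin w → ℝ} (ht : t ∈ cube w Z) :
    IsSubgradientData e kappa (startPos lam) (soloCoeff lam kappa t) (pairCoeff lam t) := by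
  classical
  refine ⟨fun i => ?_, fun i k _ => ?_⟩
  · have h1 := h.zAt_eq he (startPos lam i)
    rw [if_congr (eq_pivot_iff he h hq i).symm rfl rfl] at h1
    have h2 : (zAt e kappa (startPos lam i) : ℝ) = zAt e kappa (startPos lam i - 1) +
        if i = pivot lam i then 1 else 0 := by exact_mod_cast h1
    rw [h2]
    unfold soloCoeff
    obtain ⟨-, h3, h4⟩ := ht i
    split_ifs <;> constructor <;> linarith
  · unfold pairCoeff
    split_ifs with h1 h2
    · obtain ⟨-, h3, h4⟩ := ht i
      rw [h1, add_sub_cancel_left]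
      simp only [unitStep, le_refl, if_true]
      rw [if_neg (by omega)]
      constructor <;> linarith
    · obtain ⟨-, h3, h4⟩ := ht k
      rw [h1, add_sub_cancel_left]
      simp only [unitStep, le_refl, if_true]
      rw [if_neg (by omega)]
      constructor <;> linarith
    · exact ⟨unitStep_mono e (by omega), le_rfl⟩

theorem soloCoeff_mem {lam : WeightPartition e w} {kappa : YoungDiagram} {Z : AddSubgroup ℝ}
    (hZ : (1 : ℝ) ∈ Z) {t : Fin w → ℝ} (ht : t ∈ cube w Z) (i : Fin w) :
    soloCoeff lam kappa t i ∈ Z := by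
  have hN : ∀ n : ℕ, (n : ℝ) ∈ Z := fun n => by simpa using Z.nsmul_mem hZ n
  refine Z.add_mem (hN _) ?_
  split_ifs
  exacts [(ht i).1, Z.zero_mem]

theorem pairCoeff_mem {lam : WeightPartition e w} {Z : AddSubgroup ℝ}
    (hZ : (1 : ℝ) ∈ Z) {t : Fin w → ℝ} (ht : t ∈ cube w Z) (i k : Fin w) :
    pairCoeff lam t i k ∈ Z := by
  unfold pairCoeff unitStep
  split_ifs
  exacts [Z.sub_mem hZ (ht i).1, (ht k).1, hZ, Z.zero_mem]

/-- Every choice of subgradients at the positions of the movements comes from a point of the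
parallelotope. -/
theorem exists_point_eq_assemble (he : 2 ≤ e) {lam : WeightPartition e w} {kappa : YoungDiagram}
    (h : HasCore e lam.1 kappa) (hq : Function.Injective (startPos lam)) {Z : AddSubgroup ℝ}
    (hZ : (1 : ℝ) ∈ Z) {u : Fin w → ℝ} {r : Fin w → Fin w → ℝ}
    (hur : IsSubgradientData e kappa (startPos lam) u r) (hu : ∀ i, u i ∈ Z)
    (hr : ∀ i k, r i k ∈ Z) : ∃ t ∈ cube w Z, point lam t = assemble u r := by
  classical
  have hmono := (startPos_mono lam).strictMono_of_injective hq
  have hN : ∀ n : ℕ, (n : ℝ) ∈ Z := fun n => by simpa using Z.nsmul_mem hZ n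
  have hstep : ∀ i, (zAt e kappa (startPos lam i) : ℝ) = zAt e kappa (startPos lam i - 1) +
      if i = pivot lam i then 1 else 0 := by
    intro i
    have h1 := h.zAt_eq he (startPos lam i)
    rw [if_congr (eq_pivot_iff he h hq i).symm rfl rfl] at h1
    exact_mod_cast h1
  -- The subgradient at a difference `e` lies between `0` and `1`.
  have hpair : ∀ i k, startPos lam k = startPos lam i + e → 0 ≤ r i k ∧ r i k ≤ 1 := by
    intro i k hik
    have h1 := hur.2 i k (hmono.lt_iff_lt.1 (by omega))
    rw [hik, add_sub_cancel_left] at h1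
    simp only [unitStep, le_refl, if_true] at h1
    rwa [if_neg (by omega)] at h1
  have hex : ∀ i, ∃ s : ℝ, (s ∈ Z ∧ 0 ≤ s ∧ s ≤ 1) ∧
      (i = pivot lam i → s = u i - zAt e kappa (startPos lam i - 1)) ∧
      (i < pivot lam i → ∀ k, startPos lam k = startPos lam i + e → s = 1 - r i k) ∧
      (pivot lam i < i → ∀ k, startPos lam i = startPos lam k + e → s = r k i) := by
    intro i
    rcases lt_trichotomy i (pivot lam i) with hi | hi | hi
    · obtain ⟨k, hk⟩ := exists_startPos_eq_add he h hq hi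
      obtain ⟨h1, h2⟩ := hpair i k hk
      refine ⟨1 - r i k, ⟨Z.sub_mem hZ (hr _ _), by linarith, by linarith⟩,
        fun h' => absurd h' hi.ne, fun _ l hl => ?_, fun h' => absurd h' hi.not_gt⟩
      rw [hq (hl.trans hk.symm)]
    · have h1 := hur.1 i
      have h2 := hstep i
      rw [if_pos hi] at h2
      exact ⟨u i - zAt e kappa (startPos lam i - 1), ⟨Z.sub_mem (hu i) (hN _), by linarith,
        by linarith⟩, fun _ => rfl, fun h' => absurd hi h'.ne, fun h' => absurd hi h'.ne'⟩
    · obtain ⟨k, hk⟩ := exists_startPos_eq_sub he h hq hi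
      obtain ⟨h1, h2⟩ := hpair k i (by omega)
      refine ⟨r k i, ⟨hr _ _, h1, h2⟩, fun h' => absurd h' hi.ne', fun h' => absurd h' hi.not_gt,
        fun _ l hl => ?_⟩
      rw [hq (show startPos lam l = startPos lam k by omega)]
  choose t ht htp htl htr using hex
  refine ⟨t, ht, ?_⟩
  rw [point_eq_assemble he h hq]
  have hsolo : soloCoeff lam kappa t = u := by
    ext i
    unfold soloCoeff
    split_ifs with hi
    · rw [htp i hi]
      ring
    · have h1 := hur.1 i
      rw [hstep i, if_neg hi] at h1
      linarith
  have hpairs : ∀ i k, i < k → pairCoeff lam t i k = r i k := by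
    intro i k hik
    unfold pairCoeff
    split_ifs with h1 h2
    · rw [htl i h2 k h1]
      ring
    · refine htr k (not_le.1 fun hle => h2 ?_) i h1
      exact (lt_pivot_iff_of_add he hq h1).2 hle
    · have h3 := hur.2 i k hik
      have h4 : unitStep e (startPos lam k - startPos lam i - 1) =
          unitStep e (startPos lam k - startPos lam i) := by
        unfold unitStep
        exact if_congr (by omega) rfl rfl
      rw [h4] at h3
      linarith
  rw [hsolo]
  ext i
  unfold assemble
  congr 2
  · congr 1
    refine Finset.sum_congr rfl fun k _ => ?_
    split_ifs with hk
    exacts [hpairs k i hk, rfl]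
  · refine Finset.sum_congr rfl fun k _ => ?_
    split_ifs with hk
    exacts [hpairs i k hk, rfl]

end

section
variable {e w : ℕ}

/-! ### Intersections of parallelotopes -/

/-- A convex potential, depending only on the core, whose subgradients are the vectors assembled
from subgradient data. -/
theorem exists_potential {lam kappa : YoungDiagram} (he : 2 ≤ e) (h : HasCore e lam kappa) :
    ∃ Φ : (Fin w → ℤ) → ℝ, ∀ q u r, IsSubgradientData e kappa q u r → ∀ q' : Fin w → ℤ,
      ∑ i, assemble u r i * ((q' i : ℝ) - q i) ≤ Φ q' - Φ q ∧
      (∑ i, assemble u r i * ((q' i : ℝ) - q i) = Φ q' - Φ q →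
        IsSubgradientData e kappa q' u r) := by
  have hN : Monotone fun x : ℤ => (zAt e kappa x : ℝ) := fun a b hab => by
    have : (zAt e kappa a : ℤ) ≤ zAt e kappa b := h.zAt_mono he hab
    beta_reduce
    exact_mod_cast this
  obtain ⟨F, hF⟩ := exists_primitive fun x => (zAt e kappa x : ℝ)
  obtain ⟨G, hG⟩ := exists_primitive (unitStep e)
  refine ⟨fun q => ∑ i, (F (q i) + ((w : ℝ) - 2 * (i : ℝ) - 1) * q i) +
    ∑ i, ∑ k, if i < k then G (q k - q i) else 0, fun q u r hur q' => ?_⟩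
  set A : Fin w → ℝ := fun i => F (q' i) - F (q i) - u i * ((q' i : ℝ) - q i) with hA
  set B : Fin w → Fin w → ℝ := fun i k => if i < k then
    G (q' k - q' i) - G (q k - q i) - r i k * (((q' k - q' i : ℤ) : ℝ) - (q k - q i : ℤ))
    else 0 with hB
  have hA0 : ∀ i, 0 ≤ A i := fun i =>
    sub_nonneg.2 (subgradient_le hN hF (hur.1 i).1 (hur.1 i).2 _)
  have hB0 : ∀ i k, 0 ≤ B i k := by
    intro i k
    simp only [hB]
    split_ifs with hik
    · exact sub_nonneg.2 (subgradient_le (unitStep_mono e) hG (hur.2 i k hik).1 (hur.2 i k hik).2 _)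
    · exact le_rfl
  have hcomm : ∑ i, (∑ k, if k < i then r k i else 0) * ((q' i : ℝ) - q i) =
      ∑ i, ∑ k, if i < k then r i k * ((q' k : ℝ) - q k) else 0 := by
    rw [Finset.sum_comm]
    refine Finset.sum_congr rfl fun i _ => ?_
    rw [Finset.sum_mul]
    refine Finset.sum_congr rfl fun k _ => ?_
    split_ifs <;> simp
  have hgap : (∑ i, (F (q' i) + ((w : ℝ) - 2 * (i : ℝ) - 1) * q' i) +
      ∑ i, ∑ k, if i < k then G (q' k - q' i) else 0) -
      (∑ i, (F (q i) + ((w : ℝ) - 2 * (i : ℝ) - 1) * q i) +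
      ∑ i, ∑ k, if i < k then G (q k - q i) else 0) -
      ∑ i, assemble u r i * ((q' i : ℝ) - q i) = ∑ i, A i + ∑ i, ∑ k, B i k := by
    have h1 : ∑ i, assemble u r i * ((q' i : ℝ) - q i) =
        (∑ i, u i * ((q' i : ℝ) - q i)) +
        ∑ i, (∑ k, if k < i then r k i else 0) * ((q' i : ℝ) - q i) -
        ∑ i, (∑ k, if i < k then r i k else 0) * ((q' i : ℝ) - q i) +
        ∑ i : Fin w, ((w : ℝ) - 2 * (i : ℝ) - 1) * ((q' i : ℝ) - q i) := by
      rw [← Finset.sum_add_distrib, ← Finset.sum_sub_distrib, ← Finset.sum_add_distrib]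
      refine Finset.sum_congr rfl fun i _ => ?_
      unfold assemble
      ring
    have h2 : ∑ i, ∑ k, B i k = (∑ i, ∑ k, if i < k then G (q' k - q' i) else 0) -
        (∑ i, ∑ k, if i < k then G (q k - q i) else 0) -
        ((∑ i, ∑ k, if i < k then r i k * ((q' k : ℝ) - q k) else 0) -
        ∑ i, (∑ k, if i < k then r i k else 0) * ((q' i : ℝ) - q i)) := by
      simp only [Finset.sum_mul, ← Finset.sum_sub_distrib]
      refine Finset.sum_congr rfl fun i _ => Finset.sum_congr rfl fun k _ => ?_
      simp only [hB]
      split_ifs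
      · push_cast
        ring
      · ring
    rw [h1, hcomm, h2]
    simp only [hA, Finset.sum_add_distrib, Finset.sum_sub_distrib, mul_sub]
    ring
  have hAs : 0 ≤ ∑ i, A i := Finset.sum_nonneg fun i _ => hA0 i
  have hBs : 0 ≤ ∑ i, ∑ k, B i k :=
    Finset.sum_nonneg fun i _ => Finset.sum_nonneg fun k _ => hB0 i k
  refine ⟨by linarith, fun heq => ?_⟩
  have hA1 : ∑ i, A i = 0 := by linarith
  have hB1 : ∑ i, ∑ k, B i k = 0 := by linarith
  rw [Finset.sum_eq_zero_iff_of_nonneg fun i _ => hA0 i] at hA1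
  rw [Finset.sum_eq_zero_iff_of_nonneg fun i _ => Finset.sum_nonneg fun k _ => hB0 i k] at hB1
  refine ⟨fun i => subgradient_of_eq hN hF (hur.1 i).1 (hur.1 i).2 (hA1 i (Finset.mem_univ i)),
    fun i k hik => ?_⟩
  have h3 := hB1 i (Finset.mem_univ i)
  rw [Finset.sum_eq_zero_iff_of_nonneg fun k _ => hB0 i k] at h3
  have h4 := h3 k (Finset.mem_univ k)
  simp only [hB, if_pos hik] at h4
  exact subgradient_of_eq (unitStep_mono e) hG (hur.2 i k hik).1 (hur.2 i k hik).2 h4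

/-- Two parallelotopes of a block are weakly separated by a hyperplane which meets the first one
only in points of the second one. -/
theorem exists_separating (he : 2 ≤ e) {lam mu : WeightPartition e w} {kappa : YoungDiagram}
    (hlam : HasCore e lam.1 kappa) (hmu : HasCore e mu.1 kappa)
    (hql : Function.Injective (startPos lam)) (hqm : Function.Injective (startPos mu)) :
    ∃ (l : StrongDual ℝ (Fin w → ℝ)) (c : ℝ), ∀ Z : AddSubgroup ℝ, (1 : ℝ) ∈ Z →
      (∀ x ∈ point lam '' cube w Z, l x ≤ c ∧ (l x = c → x ∈ point mu '' cube w Z)) ∧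
      ∀ x ∈ point mu '' cube w Z, c ≤ l x := by
  obtain ⟨Φ, hΦ⟩ := exists_potential (w := w) he hlam
  refine ⟨∑ i, ((startPos mu i : ℝ) - startPos lam i) • ContinuousLinearMap.proj i,
    Φ (startPos mu) - Φ (startPos lam), fun Z hZ => ?_⟩
  have hl : ∀ x : Fin w → ℝ, (∑ i, ((startPos mu i : ℝ) - startPos lam i) •
      (ContinuousLinearMap.proj i : (Fin w → ℝ) →L[ℝ] ℝ)) x =
      ∑ i, x i * ((startPos mu i : ℝ) - startPos lam i) := by
    intro x
    simp [mul_comm]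
  constructor
  · rintro x ⟨t, ht, rfl⟩
    rw [hl]
    have hd := isSubgradientData_of_mem_cube he hlam hql ht
    rw [point_eq_assemble he hlam hql]
    obtain ⟨h1, h2⟩ := hΦ _ _ _ hd (startPos mu)
    refine ⟨h1, fun heq => ?_⟩
    obtain ⟨s, hs, hsx⟩ := exists_point_eq_assemble he hmu hqm hZ (h2 heq)
      (soloCoeff_mem hZ ht) (pairCoeff_mem hZ ht)
    exact ⟨s, hs, hsx⟩
  · rintro x ⟨t, ht, rfl⟩
    rw [hl]
    have hd := isSubgradientData_of_mem_cube he hmu hqm ht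
    rw [point_eq_assemble he hmu hqm]
    obtain ⟨h1, -⟩ := hΦ _ _ _ hd (startPos lam)
    have h3 : ∀ x : Fin w → ℝ, ∑ i, x i * ((startPos lam i : ℝ) - startPos mu i) =
        -∑ i, x i * ((startPos mu i : ℝ) - startPos lam i) := by
      intro x
      rw [← Finset.sum_neg_distrib]
      exact Finset.sum_congr rfl fun i _ => by ring
    rw [h3] at h1
    linarith

theorem solidParallelotope_eq_image_cube (lam : WeightPartition e w) :
    solidParallelotope lam = point lam '' cube w ⊤ := by
  rw [solidParallelotope_eq]
  simp [cube]

theorem mem_parallelotope_iff_mem_image_cube (lam : WeightPartition e w) (x : Fin w → ℤ) :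
    x ∈ parallelotope lam ↔
      (fun i => (x i : ℝ)) ∈ point lam '' cube w (Int.castAddHom ℝ).range := by
  rw [mem_parallelotope_iff]
  refine exists_congr fun t => and_congr_left fun _ => forall_congr' fun k => ?_
  constructor
  · rintro (h | h)
    · exact ⟨⟨0, by simp [h]⟩, by simp [h]⟩
    · exact ⟨⟨1, by simp [h]⟩, by simp [h]⟩
  · rintro ⟨⟨n, hn⟩, h0, h1⟩
    simp only [Int.coe_castAddHom] at hn
    rw [← hn] at h0 h1 ⊢
    have h0' : 0 ≤ n := by exact_mod_cast h0
    have h1' : n ≤ 1 := by exact_mod_cast h1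
    interval_cases n <;> simp

theorem isFace_inter (he : 2 ≤ e) {lam mu : WeightPartition e w} {kappa : YoungDiagram}
    (hlam : HasCore e lam.1 kappa) (hmu : HasCore e mu.1 kappa)
    (hql : Function.Injective (startPos lam)) (hqm : Function.Injective (startPos mu)) :
    IsFace (solidParallelotope lam) (solidParallelotope lam ∩ solidParallelotope mu) := by
  rintro ⟨x₀, hx₀, hx₀'⟩
  obtain ⟨l, c, hlc⟩ := exists_separating he hlam hmu hql hqm
  obtain ⟨h1, h2⟩ := hlc ⊤ trivial
  rw [← solidParallelotope_eq_image_cube] at h1 h2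
  rw [← solidParallelotope_eq_image_cube] at h1
  refine ⟨l, Set.ext fun x => ⟨fun hx => ⟨hx.1, fun y hy => ?_⟩, fun hx => ⟨hx.1, ?_⟩⟩⟩
  · exact (h1 y hy).1.trans (h2 x hx.2)
  · exact (h1 x hx.1).2 (le_antisymm (h1 x hx.1).1 ((h2 x₀ hx₀').trans (hx.2 x₀ hx₀)))

theorem isDiscreteFace_inter (he : 2 ≤ e) {lam mu : WeightPartition e w} {kappa : YoungDiagram}
    (hlam : HasCore e lam.1 kappa) (hmu : HasCore e mu.1 kappa)
    (hql : Function.Injective (startPos lam)) (hqm : Function.Injective (startPos mu)) :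
    IsDiscreteFace lam (parallelotope lam ∩ parallelotope mu) := by
  classical
  rcases (parallelotope lam ∩ parallelotope mu).eq_empty_or_nonempty with hempty | ⟨x₀, hx₀, hx₀'⟩
  · exact Or.inl hempty
  right
  obtain ⟨l, c, hlc⟩ := exists_separating he hlam hmu hql hqm
  obtain ⟨h1, h2⟩ := hlc (Int.castAddHom ℝ).range ⟨1, by simp⟩
  set a : Fin w → ℝ := fun k => l fun i => (modBasis lam k i : ℝ) with ha
  -- The vertices in the intersection are those maximizing `l`.
  have hmem : ∀ Γ, vertex lam Γ ∈ parallelotope mu ↔ l (fun i => (vertex lam Γ i : ℝ)) = c := by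
    intro Γ
    have hv := (mem_parallelotope_iff_mem_image_cube lam _).1 ⟨Γ, rfl⟩
    rw [mem_parallelotope_iff_mem_image_cube]
    exact ⟨fun h => le_antisymm (h1 _ hv).1 (h2 _ h), (h1 _ hv).2⟩
  have hle : ∀ Γ, l (fun i => (vertex lam Γ i : ℝ)) ≤ c := fun Γ =>
    (h1 _ ((mem_parallelotope_iff_mem_image_cube lam _).1 ⟨Γ, rfl⟩)).1
  have hval : ∀ Γ, l (fun i => (vertex lam Γ i : ℝ)) =
      l (fun i => (zLabel lam i : ℝ)) + ∑ k, if k ∈ Γ then a k else 0 := by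
    intro Γ
    have : (fun i => (vertex lam Γ i : ℝ)) = (fun i => (zLabel lam i : ℝ)) +
        ∑ k ∈ Γ, fun i => (modBasis lam k i : ℝ) := by
      ext i
      simp [vertex, Finset.sum_apply]
    rw [this, map_add, map_sum, Finset.sum_ite_mem, Finset.univ_inter]
  obtain ⟨Γ', rfl⟩ := hx₀
  have hc := (hmem Γ').1 hx₀'
  set Γ₁ := Finset.univ.filter fun k => 0 < a k with hΓ₁
  set Γ₀ := Finset.univ.filter fun k => a k < 0 with hΓ₀
  have hterm : ∀ (Γ : Finset (Fin w)) k,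
      0 ≤ (if k ∈ Γ₁ then a k else 0) - (if k ∈ Γ then a k else 0) := by
    intro Γ k
    have : k ∈ Γ₁ ↔ 0 < a k := by simp [hΓ₁]
    simp only [this]
    split_ifs <;> linarith
  have hdiff : ∀ Γ, l (fun i => (vertex lam Γ₁ i : ℝ)) - l (fun i => (vertex lam Γ i : ℝ)) =
      ∑ k, ((if k ∈ Γ₁ then a k else 0) - (if k ∈ Γ then a k else 0)) := by
    intro Γ
    rw [hval, hval, Finset.sum_sub_distrib]
    ring
  have hmax : l (fun i => (vertex lam Γ₁ i : ℝ)) = c := by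
    refine le_antisymm (hle _) ?_
    rw [← hc, ← sub_nonneg, hdiff]
    exact Finset.sum_nonneg fun k _ => hterm _ k
  have hiff : ∀ Γ, vertex lam Γ ∈ parallelotope mu ↔ Γ₁ ⊆ Γ ∧ Disjoint Γ Γ₀ := by
    intro Γ
    have h3 := hdiff Γ
    rw [hmax] at h3
    rw [hmem, eq_comm, ← sub_eq_zero, h3, Finset.sum_eq_zero_iff_of_nonneg fun k _ => hterm _ k]
    constructor
    · intro h
      refine ⟨fun k hk => ?_, Finset.disjoint_left.2 fun k hk hk' => ?_⟩
      · by_contra hkΓ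
        have h4 := h k (Finset.mem_univ k)
        rw [if_pos hk, if_neg hkΓ] at h4
        have : 0 < a k := (Finset.mem_filter.1 hk).2
        linarith
      · have h5 : a k < 0 := (Finset.mem_filter.1 hk').2
        have h4 := h k (Finset.mem_univ k)
        have h6 : k ∉ Γ₁ := fun h6 => h5.not_gt (Finset.mem_filter.1 h6).2
        rw [if_neg h6, if_pos hk] at h4
        linarith
    · rintro ⟨hsub, hdisj⟩ k -
      by_cases hk : k ∈ Γ₁
      · simp [hk, hsub hk]
      · by_cases hkΓ : k ∈ Γ
        · have h4 : k ∉ Γ₀ := Finset.disjoint_left.1 hdisj hkΓ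
          simp only [hΓ₁, hΓ₀, Finset.mem_filter, Finset.mem_univ, true_and, not_lt] at hk h4
          simp [le_antisymm hk h4]
        · simp [hk, hkΓ]
  refine ⟨Γ₀, Γ₁, ?_, ?_⟩
  · rw [Finset.disjoint_left]
    intro k hk hk'
    exact (Finset.mem_filter.1 hk).2.not_gt (Finset.mem_filter.1 hk').2
  · ext x
    constructor
    · rintro ⟨⟨Γ, rfl⟩, hx⟩
      exact ⟨Γ, (hiff Γ).1 hx, rfl⟩
    · rintro ⟨Γ, hΓ, rfl⟩
      exact ⟨⟨Γ, rfl⟩, (hiff Γ).2 hΓ⟩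

/-! ### Size of the parallelotopes -/

/-- All parallelotopes have their vertices in one finite box. -/
theorem parallelotope_subset (lam : WeightPartition e w) :
    parallelotope lam ⊆ Set.Icc (fun _ => -(w : ℤ)) (fun _ => (e : ℤ) + w) := by
  rintro _ ⟨Γ, rfl⟩
  have hz : ∀ i, 0 ≤ zLabel lam i ∧ zLabel lam i ≤ e := fun i =>
    ⟨Int.natCast_nonneg _, Int.ofNat_le.2 (zAt_le e lam.1 _)⟩
  have hs : ∀ a b : Fin w, 0 ≤ (Pi.single a 1 : Fin w → ℤ) b ∧
      (Pi.single a 1 : Fin w → ℤ) b ≤ 1 := by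
    intro a b
    rw [Pi.single_apply]
    split_ifs <;> simp
  have hd : ∀ a b c : Fin w, -1 ≤ (Pi.single a 1 - Pi.single b 1 : Fin w → ℤ) c ∧
      (Pi.single a 1 - Pi.single b 1 : Fin w → ℤ) c ≤ 1 := by
    intro a b c
    have h1 := hs a c
    have h2 := hs b c
    rw [Pi.sub_apply]
    omega
  have hm : ∀ k i, -1 ≤ modBasis lam k i ∧ modBasis lam k i ≤ 1 := by
    intro k i
    unfold modBasis
    split_ifs
    exacts [hd _ _ _, hd _ _ _, ⟨by linarith [hs k i], (hs k i).2⟩]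
  have hcard : (Γ.card : ℤ) ≤ w := by
    exact_mod_cast (Finset.card_le_univ Γ).trans_eq (Fintype.card_fin w)
  have hsum : ∀ i, -(w : ℤ) ≤ ∑ k ∈ Γ, modBasis lam k i ∧ ∑ k ∈ Γ, modBasis lam k i ≤ w := by
    intro i
    have h1 : ∑ k ∈ Γ, (-1 : ℤ) ≤ ∑ k ∈ Γ, modBasis lam k i :=
      Finset.sum_le_sum fun k _ => (hm k i).1
    have h2 : ∑ k ∈ Γ, modBasis lam k i ≤ ∑ k ∈ Γ, (1 : ℤ) :=
      Finset.sum_le_sum fun k _ => (hm k i).2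
    simp only [Finset.sum_const, nsmul_eq_mul] at h1 h2
    constructor <;> linarith
  constructor <;> intro i <;> simp only [vertex, Pi.add_apply, Finset.sum_apply]
  · linarith [(hz i).1, (hsum i).1]
  · linarith [(hz i).2, (hsum i).2]

/-- A functional that is constant on a parallelotope vanishes. -/
theorem eq_zero_of_modBasis (he : 2 ≤ e) {lam : WeightPartition e w} {kappa : YoungDiagram}
    (h : HasCore e lam.1 kappa) (hq : Function.Injective (startPos lam))
    (l : (Fin w → ℝ) →ₗ[ℝ] ℝ) (hl : ∀ k, l (fun i => (modBasis lam k i : ℝ)) = 0) : l = 0 := by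
  have hzero : ∀ n : ℕ, ∀ i, (startPos lam i - startPos lam (pivot lam i)).natAbs = n →
      l (Pi.single i 1) = 0 := by
    intro n
    induction n using Nat.strong_induction_on with
    | _ n ih =>
      intro i hn
      have hi := hl i
      rcases lt_trichotomy i (pivot lam i) with hlt | heq | hlt
      · obtain ⟨k, hk⟩ := exists_startPos_eq_add he h hq hlt
        have hle := (startPos_mono lam) ((lt_pivot_iff_of_add he hq hk).1 hlt)
        have hp := pivot_eq_of_add hk
        rw [hp] at hle
        have hvec : (fun j => (modBasis lam i j : ℝ)) = Pi.single i 1 - Pi.single k 1 := by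
          ext j
          rw [modBasis_apply he h hq]
          simp only [hlt, hlt.not_gt, true_and, false_and, if_false, ← hk, hq.eq_iff, Pi.sub_apply,
            Pi.single_apply, eq_comm (a := i)]
          push_cast
          ring
        rw [hvec, map_sub, ih _ _ k rfl, sub_zero] at hi
        · exact hi
        · rw [hp]
          omega
      · have hvec : (fun j => (modBasis lam i j : ℝ)) = Pi.single i 1 := by
          ext j
          rw [modBasis_apply he h hq]
          simp only [heq.not_lt, heq.not_gt, false_and, if_false, Pi.single_apply, eq_comm (a := i)]
          push_cast
          ring
        rwa [hvec] at hi
      · obtain ⟨k, hk'⟩ := exists_startPos_eq_sub he h hq hlt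
        have hk : startPos lam i = startPos lam k + e := by omega
        have hp := pivot_eq_of_add hk
        have hle : pivot lam k ≤ k := by
          by_contra hcon
          exact hlt.not_ge ((lt_pivot_iff_of_add he hq hk).1 (not_le.1 hcon))
        have hle := (startPos_mono lam) hle
        rw [← hp] at hle
        have hvec : (fun j => (modBasis lam i j : ℝ)) = Pi.single i 1 - Pi.single k 1 := by
          ext j
          rw [modBasis_apply he h hq]
          simp only [hlt, hlt.not_gt, true_and, false_and, if_false, hk, add_left_inj, hq.eq_iff,
            Pi.sub_apply, Pi.single_apply, eq_comm (a := i), eq_comm (a := k)]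
          push_cast
          ring
        rw [hvec, map_sub, ih _ _ k rfl, sub_zero] at hi
        · exact hi
        · rw [← hp]
          omega
  refine LinearMap.pi_ext' fun i => LinearMap.ext_ring ?_
  simpa using hzero _ i rfl

end

/-! ### Faces of polytopes -/

section
variable {w : ℕ}

theorem argmax_convexHull (s : Finset (Fin w → ℝ)) (l : StrongDual ℝ (Fin w → ℝ)) {m : ℝ}
    (hm : ∀ v ∈ s, l v ≤ m) {x : Fin w → ℝ} (hx : x ∈ convexHull ℝ (s : Set (Fin w → ℝ))) :
    l x ≤ m ∧ (l x = m → x ∈ convexHull ℝ {v | v ∈ s ∧ l v = m}) := by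
  classical
  obtain ⟨c, hc0, hc1, hcx⟩ := Finset.mem_convexHull'.1 hx
  have hlx : m - l x = ∑ v ∈ s, c v * (m - l v) := by
    simp only [mul_sub, Finset.sum_sub_distrib]
    rw [← Finset.sum_mul, hc1, one_mul, ← hcx, map_sum]
    simp
  have hnonneg : ∀ v ∈ s, 0 ≤ c v * (m - l v) := fun v hv =>
    mul_nonneg (hc0 v hv) (sub_nonneg.2 (hm v hv))
  refine ⟨sub_nonneg.1 (hlx ▸ Finset.sum_nonneg hnonneg), fun heq => ?_⟩
  rw [heq, sub_self, eq_comm, Finset.sum_eq_zero_iff_of_nonneg hnonneg] at hlx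
  have hzero : ∀ v ∈ s, v ∉ s.filter (fun v => l v = m) → c v = 0 := by
    intro v hv hv'
    rcases mul_eq_zero.1 (hlx v hv) with h | h
    · exact h
    · exact absurd (Finset.mem_filter.2 ⟨hv, by linarith⟩) hv'
  rw [show {v | v ∈ s ∧ l v = m} = ((s.filter fun v => l v = m : Finset _) : Set (Fin w → ℝ)) by
    ext; simp]
  refine Finset.mem_convexHull'.2 ⟨c, fun v hv => hc0 v (Finset.mem_filter.1 hv).1, ?_, ?_⟩
  · rw [← hc1]
    exact Finset.sum_subset (Finset.filter_subset _ _) hzero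
  · rw [← hcx]
    exact Finset.sum_subset (Finset.filter_subset _ _) fun v hv hv' => by
      rw [hzero v hv hv', zero_smul]

theorem IsFace.exists_subset {s : Finset (Fin w → ℝ)} {F : Set (Fin w → ℝ)}
    (h : IsFace (convexHull ℝ (s : Set (Fin w → ℝ))) F) :
    ∃ t ⊆ (s : Set (Fin w → ℝ)), F = convexHull ℝ t := by
  rcases F.eq_empty_or_nonempty with rfl | hF
  · exact ⟨∅, Set.empty_subset _, by simp⟩
  have hconv : Convex ℝ F := IsExposed.convex h (convex_convexHull ℝ _)
  obtain ⟨l, hl⟩ := h hF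
  obtain ⟨x₀, hx₀⟩ := hF
  have hx₀' := hx₀
  rw [hl] at hx₀'
  have hs : ∀ v ∈ s, l v ≤ l x₀ := fun v hv => hx₀'.2 v (subset_convexHull ℝ _ hv)
  refine ⟨{v | v ∈ s ∧ l v = l x₀}, fun v hv => hv.1, Set.Subset.antisymm (fun x hx => ?_) ?_⟩
  · rw [hl] at hx
    have h1 := argmax_convexHull s l hs hx.1
    exact h1.2 (le_antisymm h1.1 (hx.2 x₀ hx₀'.1))
  · refine convexHull_min (fun v hv => ?_) hconv
    rw [hl]
    exact ⟨subset_convexHull ℝ _ hv.1, fun y hy => hv.2 ▸ (argmax_convexHull s l hs hy).1⟩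

/-- A face of a face of a polytope is a face: a large multiple of the functional exposing the
outer face, plus the functional exposing the inner face, exposes the inner face. -/
theorem IsFace.trans {s : Finset (Fin w → ℝ)} {F G : Set (Fin w → ℝ)}
    (hF : IsFace (convexHull ℝ (s : Set (Fin w → ℝ))) F) (hG : IsFace F G) :
    IsFace (convexHull ℝ (s : Set (Fin w → ℝ))) G := by
  intro hne
  have hGF : G ⊆ F := IsExposed.subset hG
  have hGconv : Convex ℝ G :=
    IsExposed.convex hG (IsExposed.convex hF (convex_convexHull ℝ _))
  obtain ⟨l₁, hl₁⟩ := hF (hne.mono hGF)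
  obtain ⟨l₂, hl₂⟩ := hG hne
  obtain ⟨x₀, hx₀⟩ := hne
  have hx₁ := hGF hx₀
  have hx₂ := hx₀
  rw [hl₁] at hx₁
  rw [hl₂] at hx₂
  have hN : ∃ N : ℝ, ∀ v ∈ s, l₁ v < l₁ x₀ → l₂ v - l₂ x₀ < N * (l₁ x₀ - l₁ v) := by
    obtain ⟨N, hN⟩ := (s.finite_toSet.image fun v => (l₂ v - l₂ x₀) / (l₁ x₀ - l₁ v)).bddAbove
    refine ⟨N + 1, fun v hv hlt => ?_⟩
    have h1 := hN ⟨v, hv, rfl⟩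
    rw [← div_lt_iff₀ (sub_pos.2 hlt)]
    exact lt_of_le_of_lt h1 (lt_add_one N)
  obtain ⟨N, hN⟩ := hN
  have hl : ∀ x, (N • l₁ + l₂) x = N * l₁ x + l₂ x := fun x => by simp
  have hvert : ∀ v ∈ s, (N • l₁ + l₂) v ≤ (N • l₁ + l₂) x₀ ∧
      ((N • l₁ + l₂) v = (N • l₁ + l₂) x₀ → v ∈ G) := by
    intro v hv
    have hvP := subset_convexHull ℝ (s : Set (Fin w → ℝ)) hv
    rw [hl, hl]
    rcases (hx₁.2 v hvP).lt_or_eq with hlt | heq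
    · have := hN v hv hlt
      exact ⟨by linarith, fun h => by linarith⟩
    · have hvF : v ∈ F := by
        rw [hl₁]
        exact ⟨hvP, fun y hy => heq ▸ hx₁.2 y hy⟩
      have h2 := hx₂.2 v hvF
      rw [heq]
      refine ⟨by linarith, fun h => ?_⟩
      rw [hl₂]
      exact ⟨hvF, fun y hy => by linarith [hx₂.2 y hy]⟩
  have hmax := fun x hx =>
    argmax_convexHull s (N • l₁ + l₂) (fun v hv => (hvert v hv).1) (x := x) hx
  refine ⟨N • l₁ + l₂, Set.Subset.antisymm (fun x hx => ?_) fun x hx => ?_⟩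
  · have hxF := hGF hx
    rw [hl₁] at hxF
    rw [hl₂] at hx
    refine ⟨hxF.1, fun y hy => (hmax y hy).1.trans ?_⟩
    rw [hl, hl, le_antisymm (hxF.2 x₀ hx₁.1) (hx₁.2 x hxF.1)]
    linarith [hx.2 x₀ hx₂.1]
  · have h1 := hmax x hx.1
    have h2 := h1.2 (le_antisymm h1.1 (hx.2 x₀ hx₁.1))
    exact convexHull_min (fun v hv => (hvert v hv.1).2 hv.2) hGconv h2

theorem polytopeDim_le (P : Set (Fin w → ℝ)) : polytopeDim P ≤ (w : WithBot ℕ) := by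
  unfold polytopeDim
  split_ifs
  · exact bot_le
  · have := Submodule.finrank_le (affineSpan ℝ P).direction
    rw [Module.finrank_fin_fun] at this
    exact_mod_cast this

theorem direction_eq_top_of_polytopeDim {P : Set (Fin w → ℝ)}
    (h : polytopeDim P = (w : WithBot ℕ)) : P.Nonempty ∧ (affineSpan ℝ P).direction = ⊤ := by
  unfold polytopeDim at h
  split_ifs at h with hP
  · exact absurd h (WithBot.bot_ne_coe)
  · refine ⟨Set.nonempty_iff_ne_empty.2 hP, Submodule.eq_top_of_finrank_eq ?_⟩
    rw [Module.finrank_fin_fun]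
    exact_mod_cast h

/-- A full-dimensional polytope has no proper full-dimensional face. -/
theorem IsFace.eq_of_polytopeDim {P F : Set (Fin w → ℝ)} (h : IsFace P F)
    (hF : polytopeDim F = (w : WithBot ℕ)) : F = P := by
  obtain ⟨hne, htop⟩ := direction_eq_top_of_polytopeDim hF
  obtain ⟨l, hl⟩ := h hne
  have hker : (affineSpan ℝ F).direction ≤ LinearMap.ker (l : (Fin w → ℝ) →ₗ[ℝ] ℝ) := by
    rw [direction_affineSpan, vectorSpan, Submodule.span_le]
    rintro _ ⟨x, hx, y, hy, rfl⟩
    rw [hl] at hx hy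
    have := le_antisymm (hx.2 y hy.1) (hy.2 x hx.1)
    simp [this]
  have hzero : ∀ x, l x = 0 := fun x => hker (htop ▸ Submodule.mem_top)
  rw [hl]
  ext x
  simp [hzero]

/-- The complex of all faces of a family of polytopes with vertices in a finite set, any two of
which meet in a common face. -/
def complexOfPolytopes (𝓟 : Set (Set (Fin w → ℝ))) (S : Finset (Fin w → ℝ))
    (hS : ∀ P ∈ 𝓟, ∃ s ⊆ S, P = convexHull ℝ (s : Set (Fin w → ℝ)))
    (hface : ∀ P ∈ 𝓟, ∀ Q ∈ 𝓟, IsFace P (P ∩ Q)) : PolytopalComplex w :=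
  have hsub : ∀ F, (F = ∅ ∨ ∃ P ∈ 𝓟, IsFace P F) →
      ∃ t ⊆ (S : Set (Fin w → ℝ)), F = convexHull ℝ t := by
    rintro F (rfl | ⟨P, hP, hF⟩)
    · exact ⟨∅, Set.empty_subset _, by simp⟩
    · obtain ⟨s, hs, rfl⟩ := hS P hP
      obtain ⟨t, ht, rfl⟩ := hF.exists_subset
      exact ⟨t, ht.trans (Finset.coe_subset.2 hs), rfl⟩
  have hinter : ∀ F, (F = ∅ ∨ ∃ P ∈ 𝓟, IsFace P F) → ∀ G, (G = ∅ ∨ ∃ P ∈ 𝓟, IsFace P G) →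
      IsFace G (F ∩ G) := by
    rintro F (rfl | ⟨P, hP, hF⟩) G (rfl | ⟨Q, hQ, hG⟩)
    · simpa [IsFace] using isExposed_empty
    · simpa [IsFace] using isExposed_empty
    · simpa [IsFace] using isExposed_empty
    · have hPQ : IsFace Q (P ∩ Q) := Set.inter_comm Q P ▸ hface Q hQ P hP
      have h1 : IsFace (P ∩ Q) (F ∩ (P ∩ Q)) :=
        IsExposed.mono (IsExposed.inter hF (hface P hP Q hQ)) Set.inter_subset_left
          Set.inter_subset_right
      obtain ⟨s, -, rfl⟩ := hS Q hQ
      have h2 := IsExposed.inter (hPQ.trans h1) hG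
      rw [Set.inter_right_comm, Set.inter_eq_left.2] at h2
      · exact IsExposed.mono h2 (IsExposed.subset hG) Set.inter_subset_right
      · exact Set.inter_subset_inter (IsExposed.subset hF) (IsExposed.subset hG)
  { cells := {F | F = ∅ ∨ ∃ P ∈ 𝓟, IsFace P F}
    finite := (S.finite_toSet.finite_subsets.image fun t => convexHull ℝ t).subset fun F hF => by
      obtain ⟨t, ht, rfl⟩ := hsub F hF
      exact ⟨t, ht, rfl⟩
    polytope := fun F hF => by
      obtain ⟨t, ht, rfl⟩ := hsub F hF
      exact ⟨(S.finite_toSet.subset ht).toFinset, by simp⟩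
    empty_mem := Or.inl rfl
    face_mem := by
      rintro F (rfl | ⟨P, hP, hF⟩) G hG
      · exact Or.inl (Set.subset_empty_iff.1 (IsExposed.subset hG))
      · obtain ⟨s, -, rfl⟩ := hS P hP
        exact Or.inr ⟨_, hP, hF.trans hG⟩
    inter_face := fun F hF G hG =>
      ⟨Set.inter_comm G F ▸ hinter G hG F hF, hinter F hF G hG⟩ }

theorem complexOfPolytopes_isPure {𝓟 : Set (Set (Fin w → ℝ))} {S : Finset (Fin w → ℝ)}
    (hS : ∀ P ∈ 𝓟, ∃ s ⊆ S, P = convexHull ℝ (s : Set (Fin w → ℝ)))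
    (hface : ∀ P ∈ 𝓟, ∀ Q ∈ 𝓟, IsFace P (P ∩ Q))
    (hdim : ∀ P ∈ 𝓟, polytopeDim P = (w : WithBot ℕ)) :
    (complexOfPolytopes 𝓟 S hS hface).IsPure := by
  have key : ∀ P ∈ 𝓟, ∀ F ⊆ P, ∃ Q ∈ (complexOfPolytopes 𝓟 S hS hface).cells, F ⊆ Q ∧
      ∀ R ∈ (complexOfPolytopes 𝓟 S hS hface).cells, polytopeDim R ≤ polytopeDim Q :=
    fun P hP F hF => ⟨P, Or.inr ⟨P, hP, IsExposed.refl P⟩, hF,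
      fun R _ => (polytopeDim_le R).trans_eq (hdim P hP).symm⟩
  rintro F (rfl | ⟨P, hP, hF⟩)
  · rcases 𝓟.eq_empty_or_nonempty with rfl | ⟨P, hP⟩
    · refine ⟨∅, Or.inl rfl, le_rfl, ?_⟩
      rintro R (rfl | ⟨P, hP, -⟩)
      · exact le_rfl
      · exact absurd hP (Set.notMem_empty P)
    · exact key P hP _ (Set.empty_subset P)
  · exact key P hP F (IsExposed.subset hF)

theorem complexOfPolytopes_dimCells {𝓟 : Set (Set (Fin w → ℝ))} {S : Finset (Fin w → ℝ)}
    (hS : ∀ P ∈ 𝓟, ∃ s ⊆ S, P = convexHull ℝ (s : Set (Fin w → ℝ)))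
    (hface : ∀ P ∈ 𝓟, ∀ Q ∈ 𝓟, IsFace P (P ∩ Q))
    (hdim : ∀ P ∈ 𝓟, polytopeDim P = (w : WithBot ℕ)) :
    (complexOfPolytopes 𝓟 S hS hface).dimCells w = 𝓟 := by
  ext F
  constructor
  · rintro ⟨rfl | ⟨P, hP, hF⟩, hdimF⟩
    · exact absurd (direction_eq_top_of_polytopeDim hdimF).1 Set.not_nonempty_empty
    · rwa [hF.eq_of_polytopeDim hdimF]
  · exact fun hF => ⟨Or.inr ⟨F, hF, IsExposed.refl F⟩, hdim F hF⟩

end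

section
variable {e w : ℕ}

theorem polytopeDim_solidParallelotope (he : 2 ≤ e) {lam : WeightPartition e w}
    {kappa : YoungDiagram} (h : HasCore e lam.1 kappa)
    (hq : Function.Injective (startPos lam)) :
    polytopeDim (solidParallelotope lam) = (w : WithBot ℕ) := by
  classical
  have hmem : ∀ Γ, (fun i => (vertex lam Γ i : ℝ)) ∈ solidParallelotope lam :=
    fun Γ => subset_convexHull ℝ _ ⟨_, ⟨Γ, rfl⟩, rfl⟩
  have htop : (affineSpan ℝ (solidParallelotope lam)).direction = ⊤ := by
    by_contra hne
    obtain ⟨l, hl0, hl⟩ := Submodule.exists_le_ker_of_lt_top _ (lt_top_iff_ne_top.2 hne)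
    refine hl0 (eq_zero_of_modBasis he h hq l fun k => hl ?_)
    have := AffineSubspace.vsub_mem_direction
      (subset_affineSpan ℝ _ (hmem {k})) (subset_affineSpan ℝ _ (hmem ∅))
    convert this using 1
    ext i
    simp [vertex]
  unfold polytopeDim
  rw [if_neg (Set.Nonempty.ne_empty ⟨_, hmem ∅⟩), htop, finrank_top, Module.finrank_fin_fun]

theorem solidParallelotope_eq_convexHull (lam : WeightPartition e w) :
    ∃ s ⊆ (Finset.Icc (fun _ : Fin w => -(w : ℤ)) (fun _ => (e : ℤ) + w)).image
        (fun x i => (x i : ℝ)),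
      solidParallelotope lam = convexHull ℝ (s : Set (Fin w → ℝ)) := by
  classical
  have hfin : ((fun (x : Fin w → ℤ) (i : Fin w) => (x i : ℝ)) '' parallelotope lam).Finite :=
    (Set.finite_range _).image _
  refine ⟨hfin.toFinset, ?_, by simp [solidParallelotope]⟩
  intro x hx
  obtain ⟨y, hy, rfl⟩ := hfin.mem_toFinset.1 hx
  have := parallelotope_subset lam hy
  exact Finset.mem_image.2 ⟨y, Finset.mem_Icc.2 ⟨this.1, this.2⟩, rfl⟩

end
end HookQuotient

theorem corollary8p6 (e w : ℕ) (he : 2 ≤ e) (kappa : YoungDiagram) :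
    (∀ lam ∈ HookQuotient.block e kappa w, ∀ mu ∈ HookQuotient.block e kappa w,
      HookQuotient.IsHookQuotient e lam.1 → HookQuotient.IsHookQuotient e mu.1 →
        (∃ F : Set (Fin w → ℝ),
          HookQuotient.IsFace (HookQuotient.solidParallelotope lam) F ∧
          HookQuotient.IsFace (HookQuotient.solidParallelotope mu) F ∧
          HookQuotient.increasingPart 7 (HookQuotient.solidParallelotope lam) ∩
              HookQuotient.increasingPart 7 (HookQuotient.solidParallelotope mu) =
            HookQuotient.increasingPart 7 F) ∧
        (HookQuotient.IsIncreasingPartition 10 lam ∨ HookQuotient.IsIncreasingPartition 10 mu →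
          (HookQuotient.IsFace (HookQuotient.solidParallelotope lam)
              (HookQuotient.solidParallelotope lam ∩ HookQuotient.solidParallelotope mu) ∧
            HookQuotient.IsFace (HookQuotient.solidParallelotope mu)
              (HookQuotient.solidParallelotope lam ∩ HookQuotient.solidParallelotope mu)) ∧
          (HookQuotient.IsDiscreteFace lam
              (HookQuotient.parallelotope lam ∩ HookQuotient.parallelotope mu) ∧
            HookQuotient.IsDiscreteFace mu
              (HookQuotient.parallelotope lam ∩ HookQuotient.parallelotope mu)))) ∧
    ∃ K : HookQuotient.PolytopalComplex w, K.IsPure ∧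
      K.dimCells w = {P | ∃ lam ∈ HookQuotient.block e kappa w,
        HookQuotient.IsIncreasingPartition 10 lam ∧
          P = HookQuotient.solidParallelotope lam} := by
  open HookQuotient in
  constructor
  · intro lam hlam mu hmu hhl hhm
    have hql := hhl.startPos_injective he
    have hqm := hhm.startPos_injective he
    have hface₁ := isFace_inter he hlam hmu hql hqm
    have hface₂ := isFace_inter he hmu hlam hqm hql
    rw [Set.inter_comm] at hface₂
    have hdisc₁ := isDiscreteFace_inter he hlam hmu hql hqm
    have hdisc₂ := isDiscreteFace_inter he hmu hlam hqm hql
    rw [Set.inter_comm] at hdisc₂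
    refine ⟨⟨_, hface₁, hface₂, ?_⟩, fun _ => ⟨⟨hface₁, hface₂⟩, hdisc₁, hdisc₂⟩⟩
    exact Set.ext fun x => ⟨fun hx => ⟨⟨hx.1.1, hx.2.1⟩, hx.1.2⟩,
      fun hx => ⟨⟨hx.1.1, hx.2⟩, ⟨hx.1.2, hx.2⟩⟩⟩
  · have hinj : ∀ lam : WeightPartition e w, IsIncreasingPartition 10 lam →
        Function.Injective (startPos lam) := fun lam h => h.startPos_injective (by norm_num)
    have hS : ∀ P ∈ {P | ∃ lam ∈ block e kappa w, IsIncreasingPartition 10 lam ∧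
        P = solidParallelotope lam}, ∃ s ⊆ (Finset.Icc (fun _ : Fin w => -(w : ℤ))
          (fun _ => (e : ℤ) + w)).image (fun x i => (x i : ℝ)),
        P = convexHull ℝ (s : Set (Fin w → ℝ)) := by
      rintro _ ⟨lam, -, -, rfl⟩
      exact solidParallelotope_eq_convexHull lam
    have hface : ∀ P ∈ {P | ∃ lam ∈ block e kappa w, IsIncreasingPartition 10 lam ∧
        P = solidParallelotope lam}, ∀ Q ∈ {P | ∃ lam ∈ block e kappa w,
          IsIncreasingPartition 10 lam ∧ P = solidParallelotope lam}, IsFace P (P ∩ Q) := by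
      rintro _ ⟨lam, hlam, hil, rfl⟩ _ ⟨mu, hmu, him, rfl⟩
      exact isFace_inter he hlam hmu (hinj lam hil) (hinj mu him)
    have hdim : ∀ P ∈ {P | ∃ lam ∈ block e kappa w, IsIncreasingPartition 10 lam ∧
        P = solidParallelotope lam}, polytopeDim P = (w : WithBot ℕ) := by
      rintro _ ⟨lam, hlam, hil, rfl⟩
      exact polytopeDim_solidParallelotope he hlam (hinj lam hil)
    exact ⟨complexOfPolytopes _ _ hS hface, complexOfPolytopes_isPure hS hface hdim,
      complexOfPolytopes_dimCells hS hface hdim⟩
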